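/- Let $\Theta\subseteq\mathbb R^d$ be measurable, and for $\theta\in\Theta$ let $p(\cdot\mid\theta)$ be a probability density on $\mathbb R^p$ (with respect to Lebesgue measure), jointly measurable in $(y,\theta)$. For $n\ge 1$ write $p_\theta^{(n)}(y_1,\dots,y_n)=\prod_{i=1}^n p(y_i\mid\theta)$ for the density, and $P_\theta^{(n)}$ for the law, of $n$ i.i.d. observations $Y^{(n)}=(Y_1,\dots,Y_n)$. Let $P_\theta$ be a prior on $\Theta$ with Lebesgue density $p_\theta$, let $\theta^*\in\Theta$ be the true parameter, and let $\alpha\in(0,1)$. Define: - $D(P\|Q)=\int\log\frac{dP}{dQ}\,dP$ and $V(P\|Q)=\int\log^2\frac{dP}{dQ}\,dP$ (both $+\infty$ if $P\not\ll Q$), and $$B_n(\theta^*,\varepsilon)=\{\theta\in\Theta:\ D(P_{\theta^*}^{(n)}\|P_\theta^{(n)})\le n\varepsilon^2,\ V(P_{\theta^*}^{(n)}\|P_\theta^{(n)})\le n\varepsilon^2\};$$ - the Rényi divergence $D_\alpha^{(n)}(\theta,\theta^*)=\frac{1}{\alpha-1}\log\int (p_\theta^{(n)})^\alpha (p_{\theta^*}^{(n)})^{1-\alpha}\,dy\in[0,\infty]$;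 - the $\alpha$-fractional posterior $P_\alpha(B\mid Y^{(n)})=\int_B p_\theta^{(n)}(Y^{(n)})^\alpha p_\theta(\theta)\,d\theta\big/\int_\Theta p_\theta^{(n)}(Y^{(n)})^\alpha p_\theta(\theta)\,d\theta$; - the GP-IVI family $\mathcal Q_{GP}=\{q_{\mu,\sigma}(\theta)=\int_0^1\phi_\sigma(\theta-\mu(\eta))\,d\eta:\ \mu\in C([0,1],\mathbb R^d),\ \sigma>0\}$, where $\phi_\sigma$ is the density of $N(0,\sigma^2I_d)$. For a family $\mathcal Q$ of probability densities on $\mathbb R^d$, an $\alpha$-VB minimiser over $\mathcal Q$ is a $\widehat q\in\mathcal Q$ at which $q\mapsto D(q\,\|\,P_\alpha(\cdot\mid Y^{(n)}))$ attains its minimum over $\mathcal Q$, the minimum being finite. Theorem. For all $\alpha\in(0,1)$ and $D>1$ there is a constant $C\ge 0$, depending only on $\alpha$ and $D$, such that for every model, prior and $\theta^*$ as above and all $n\ge1$ and $\varepsilon>0$ with $P_\theta[B_n(\theta^*,\varepsilon)]>0$, the following holds with $P_{\theta^*}^{(n)}$-probability at least $1-\frac{2}{(D-1)^2n\varepsilon^2}$: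 every $\alpha$-VB minimiser $\widehat q$ over $\mathcal Q_{GP}$ with $\widehat q\ll p_\theta$ satisfies $$\int\frac1n D_\alpha^{(n)}(\theta,\theta^*)\,\widehat q(\theta)\,d\theta\ \le\ \frac{D\alpha}{1-\alpha}\varepsilon^2+\frac{1}{n(1-\alpha)}\log\big\{P_\theta[B_n(\theta^*,\varepsilon)]^{-1}\big\}+\frac{C}{n}.$$ Thus GP-IVI attains the optimal $\alpha$-VB risk bound, namely that of the unrestricted variational family: on the same event the same inequality holds for every $\alpha$-VB minimiser $\widehat q\ll p_\theta$ over the family of all probability densities on $\mathbb R^d$. -/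

import Mathlib

open MeasureTheory
open scoped ENNReal

namespace GPIVI

noncomputable section

/-- Euclidean space `ℝᵏ`. -/
abbrev Vec (k : ℕ) := EuclideanSpace ℝ (Fin k)

/-- The measure on `ℝᵏ` with Lebesgue density `q`. -/
def densMeasure {k : ℕ} (q : Vec k → ℝ) : Measure (Vec k) :=
  volume.withDensity fun x => ENNReal.ofReal (q x)

/-- A dominated statistical model for one observation in `ℝᵖ`, with parameter set `Θ ⊆ ℝᵈ`,
Lebesgue densities `dens θ` (`θ ∈ Θ`), and a prior on `Θ` with Lebesgue density `prior`.
The values of `dens θ` for `θ ∉ Θ` are irrelevant. -/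
structure BayesModel (p d : ℕ) where
  Θ : Set (Vec d)
  measurableSet_Θ : MeasurableSet Θ
  dens : Vec d → Vec p → ℝ
  measurable_dens : Measurable (Function.uncurry dens)
  dens_nonneg : ∀ θ y, 0 ≤ dens θ y
  lintegral_dens : ∀ θ ∈ Θ, ∫⁻ y, ENNReal.ofReal (dens θ y) = 1
  prior : Vec d → ℝ
  measurable_prior : Measurable prior
  prior_nonneg : ∀ θ, 0 ≤ prior θ
  prior_eq_zero : ∀ θ, θ ∉ Θ → prior θ = 0
  lintegral_prior : ∫⁻ θ, ENNReal.ofReal (prior θ) = 1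

/-- `∫ (log (dμ/dν))² dμ`, with value `∞` if `μ` is not absolutely continuous w.r.t. `ν`. -/
def vDiv {X : Type*} [MeasurableSpace X] (μ ν : Measure X) : ℝ≥0∞ :=
  open Classical in
  if μ ≪ ν then ∫⁻ x, ENNReal.ofReal (llr μ ν x ^ 2) ∂μ else ∞

namespace BayesModel

variable {p d : ℕ} (M : BayesModel p d)

/-- The density `p(y | θ)` of `n` independent observations `y = (y₁, …, yₙ)`. -/
def lik (n : ℕ) (θ : Vec d) (y : Fin n → Vec p) : ℝ := ∏ i, M.dens θ (y i)

/-- The law of `n` independent observations with parameter `θ`. -/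
def law (n : ℕ) (θ : Vec d) : Measure (Fin n → Vec p) :=
  volume.withDensity fun y => ENNReal.ofReal (M.lik n θ y)

/-- The prior distribution of the parameter. -/
def priorMeasure : Measure (Vec d) := densMeasure M.prior

/-- The neighbourhood `Bₙ(θ₀, ε)` of `θ₀`, given by the Kullback-Leibler and the V-divergence of
the joint laws of the `n` observations. -/
def klBall (n : ℕ) (θ₀ : Vec d) (ε : ℝ) : Set (Vec d) :=
  {θ | θ ∈ M.Θ ∧
    InformationTheory.klDiv (M.law n θ₀) (M.law n θ) ≤ ENNReal.ofReal (n * ε ^ 2) ∧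
    vDiv (M.law n θ₀) (M.law n θ) ≤ ENNReal.ofReal (n * ε ^ 2)}

/-- The integral `∫ p(y | θ)^α p(y | θ₀)^(1 - α) dy`. -/
def affinity (α : ℝ) (n : ℕ) (θ θ₀ : Vec d) : ℝ≥0∞ :=
  ∫⁻ y, ENNReal.ofReal (M.lik n θ y ^ α * M.lik n θ₀ y ^ (1 - α))

/-- The Rényi divergence `(α - 1)⁻¹ log ∫ p(y | θ)^α p(y | θ₀)^(1 - α) dy` of order `α ∈ (0, 1)`
between the joint laws of the `n` observations under `θ` and under `θ₀`; it is `∞` when these are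
mutually singular. -/
def renyi (α : ℝ) (n : ℕ) (θ θ₀ : Vec d) : ℝ≥0∞ :=
  open Classical in
  if M.affinity α n θ θ₀ = 0 then ∞
  else ENNReal.ofReal ((α - 1)⁻¹ * Real.log (M.affinity α n θ θ₀).toReal)

/-- The unnormalised `α`-fractional posterior `B ↦ ∫_B p(y | θ)^α prior(θ) dθ`. -/
def fracUnnorm (α : ℝ) (n : ℕ) (y : Fin n → Vec p) : Measure (Vec d) :=
  densMeasure fun θ => M.lik n θ y ^ α * M.prior θ

/-- The `α`-fractional posterior given the data `y`. -/
def fracPosterior (α : ℝ) (n : ℕ) (y : Fin n → Vec p) : Measure (Vec d) :=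
  (M.fracUnnorm α n y Set.univ)⁻¹ • M.fracUnnorm α n y

/-- `q` minimises `D(q ‖ α-fractional posterior)` over the family `𝒬`, the minimum being finite. -/
def IsAlphaVBMinimiser (𝒬 : Set (Vec d → ℝ)) (α : ℝ) (n : ℕ) (y : Fin n → Vec p)
    (q : Vec d → ℝ) : Prop :=
  q ∈ 𝒬 ∧
  InformationTheory.klDiv (densMeasure q) (M.fracPosterior α n y) ≠ ∞ ∧
  ∀ q' ∈ 𝒬, InformationTheory.klDiv (densMeasure q) (M.fracPosterior α n y) ≤
    InformationTheory.klDiv (densMeasure q') (M.fracPosterior α n y)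

/-- The variational risk `∫ n⁻¹ D_α(θ, θ₀) q(θ) dθ`. -/
def risk (α : ℝ) (n : ℕ) (θ₀ : Vec d) (q : Vec d → ℝ) : ℝ≥0∞ :=
  ∫⁻ θ, M.renyi α n θ θ₀ / n ∂(densMeasure q)

end BayesModel

/-- The density of the normal distribution `N(0, σ² I_d)`. -/
def gaussDens {d : ℕ} (σ : ℝ) (t : Vec d) : ℝ :=
  (Real.sqrt (2 * Real.pi * σ ^ 2))⁻¹ ^ d * Real.exp (-‖t‖ ^ 2 / (2 * σ ^ 2))

/-- The implicit variational density `q_{μ,σ}(θ) = ∫₀¹ φ_σ(θ - μ(η)) dη`. -/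
def gpDens {d : ℕ} (μ : C(unitInterval, Vec d)) (σ : ℝ) (θ : Vec d) : ℝ :=
  ∫ η : unitInterval, gaussDens σ (θ - μ η)

/-- The GP-IVI variational family on `ℝᵈ`. -/
def gpFamily (d : ℕ) : Set (Vec d → ℝ) :=
  {q | ∃ (μ : C(unitInterval, Vec d)) (σ : ℝ), 0 < σ ∧ q = gpDens μ σ}

/-- The unrestricted variational family: all probability densities on `ℝᵈ`. -/
def allDensities (d : ℕ) : Set (Vec d → ℝ) :=
  {q | Measurable q ∧ (∀ θ, 0 ≤ q θ) ∧ ∫⁻ θ, ENNReal.ofReal (q θ) = 1}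

end

end GPIVI

/-!
Fix `θ₀` and let `a(θ)` be the affinity `∫ p(y | θ)^α p(y | θ₀)^(1 - α) dy`, so that
`(1 - α) D_α(θ, θ₀) = -log a(θ)`. Chebyshev's inequality for the log-likelihood ratio averaged over
the prior restricted to `Bₙ(θ₀, ε)`, together with Jensen's inequality, bounds the normalising
constant of the fractional posterior from below. Since `p(y | θ)^α p(y | θ₀)^(-α) / a(θ)` has mean
at most one under `θ₀`, Markov's inequality bounds the unnormalised posterior integral of `1 / a`
from above. On the intersection of the two events the posterior integral of `1 / a`, and hence by
concavity of `log` that of `(1 - α) D_α`, is controlled.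

It remains to see that a minimiser is the fractional posterior itself, i.e. that the infimum of
the divergence over the family vanishes. For GP-IVI, suppose that some member of the family has
finite divergence from the posterior density `r`. Then `r > 0` almost everywhere and the
divergence from `r` is finite on all densities dominated by a multiple of some Gaussian
`exp (-b ‖θ‖²)`. By dominated convergence, `r` is approximated in divergence by its truncations
below such multiples, these by continuous densities of compact support, these by their Gaussian
mollifications with small variance, and these by members of the family, since every law of compact
support is the image of Lebesgue measure on `[0, 1]` under a bounded measurable map, an almost
everywhere limit of continuous paths.
-/

namespace GPIVI

open InformationTheory ProbabilityTheory Filter Topology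

/-! ### The Kullback-Leibler divergence in terms of densities -/

section KLDens

variable {X : Type*} [MeasurableSpace X] {μ : Measure X}

lemma rnDeriv_withDensity_ofReal [SigmaFinite μ] {q r : X → ℝ} (hq : Measurable q)
    (hr : Measurable r) [SigmaFinite (μ.withDensity fun x => ENNReal.ofReal (q x))]
    [SigmaFinite (μ.withDensity fun x => ENNReal.ofReal (r x))] :
    (μ.withDensity fun x => ENNReal.ofReal (q x)).rnDeriv
        (μ.withDensity fun x => ENNReal.ofReal (r x))
      =ᵐ[μ.withDensity fun x => ENNReal.ofReal (r x)]
        fun x => ENNReal.ofReal (q x) / ENNReal.ofReal (r x) := by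
  have hqμ := withDensity_absolutelyContinuous μ fun x => ENNReal.ofReal (q x)
  have hrμ := withDensity_absolutelyContinuous μ fun x => ENNReal.ofReal (r x)
  filter_upwards [Measure.rnDeriv_eq_div hqμ hrμ,
    hrμ.ae_le (Measure.rnDeriv_withDensity μ hq.ennreal_ofReal),
    hrμ.ae_le (Measure.rnDeriv_withDensity μ hr.ennreal_ofReal)] with x h hqx hrx
  rw [h, hqx, hrx]

/-- The Kullback-Leibler divergence of the measures with `μ`-densities `q ≥ 0` and `r > 0`. -/
noncomputable def klDens (μ : Measure X) (q r : X → ℝ) : ℝ≥0∞ :=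
  ∫⁻ x, ENNReal.ofReal (r x * klFun (q x / r x)) ∂μ

/-- `r` is the density of a finite measure equivalent to `μ`. -/
structure IsPosDensity (μ : Measure X) (r : X → ℝ) : Prop where
  measurable : Measurable r
  pos : ∀ᵐ x ∂μ, 0 < r x
  integrable : Integrable r μ

lemma IsPosDensity.klDiv_withDensity [SigmaFinite μ] {q r : X → ℝ} (hr : IsPosDensity μ r)
    (hq : Measurable q) (hq0 : ∀ x, 0 ≤ q x) (hqi : Integrable q μ) :
    klDiv (μ.withDensity fun x => ENNReal.ofReal (q x))
      (μ.withDensity fun x => ENNReal.ofReal (r x)) = klDens μ q r := by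
  have := isFiniteMeasure_withDensity_ofReal hqi.2
  have := isFiniteMeasure_withDensity_ofReal hr.integrable.2
  have hac : (μ.withDensity fun x => ENNReal.ofReal (q x)) ≪
      μ.withDensity fun x => ENNReal.ofReal (r x) :=
    (withDensity_absolutelyContinuous μ _).trans <| withDensity_absolutelyContinuous'
      hr.measurable.ennreal_ofReal.aemeasurable <| by
        filter_upwards [hr.pos] with x hx using (ENNReal.ofReal_pos.2 hx).ne'
  have hcongr : ∀ᵐ x ∂(μ.withDensity fun x => ENNReal.ofReal (r x)),
      ENNReal.ofReal (klFun (((μ.withDensity fun x => ENNReal.ofReal (q x)).rnDeriv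
        (μ.withDensity fun x => ENNReal.ofReal (r x)) x).toReal)) =
      ENNReal.ofReal (klFun (q x / r x)) := by
    filter_upwards [rnDeriv_withDensity_ofReal hq hr.measurable,
      (withDensity_absolutelyContinuous μ _).ae_le hr.pos] with x hx hrx
    rw [hx, ENNReal.toReal_div, ENNReal.toReal_ofReal (hq0 x), ENNReal.toReal_ofReal hrx.le]
  have hm : Measurable fun x => ENNReal.ofReal (klFun (q x / r x)) :=
    (measurable_klFun.comp (hq.div hr.measurable)).ennreal_ofReal
  rw [klDiv_eq_lintegral_klFun_of_ac hac, lintegral_congr_ae hcongr,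
    lintegral_withDensity_eq_lintegral_mul _ hr.measurable.ennreal_ofReal hm]
  refine lintegral_congr_ae ?_
  filter_upwards [hr.pos] with x hx
  simp only [Pi.mul_apply, ENNReal.ofReal_mul hx.le]

lemma klFun_le_one_add {x y : ℝ} (hx : 0 ≤ x) (hxy : x ≤ y) : klFun x ≤ 1 + klFun y := by
  have hmax := convexOn_klFun.le_max_of_mem_Icc (Set.mem_Ici.2 le_rfl)
    (Set.mem_Ici.2 (hx.trans hxy)) ⟨hx, hxy⟩
  rw [klFun_zero] at hmax
  exact hmax.trans (max_le_add_of_nonneg zero_le_one (klFun_nonneg (hx.trans hxy)))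

lemma klFun_mul_le {c x : ℝ} (hc : 0 ≤ c) (hx : 0 ≤ x) :
    klFun (c * x) ≤ c * klFun x + c * |Real.log c| * x + 1 := by
  rcases hc.eq_or_lt with rfl | hc
  · simp [klFun_zero]
  rcases hx.eq_or_lt with rfl | hx
  · simp [klFun_zero, hc.le]
  · have hlog : c * x * Real.log c ≤ c * x * |Real.log c| := by
      gcongr
      exact le_abs_self _
    rw [klFun_apply, klFun_apply, Real.log_mul hc.ne' hx.ne']
    nlinarith

/-- A nonnegative integrable function `E` of finite divergence from `r`: it dominates every family
of densities below it in the integral defining `klDens`. -/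
structure IsEnvelope (μ : Measure X) (r E : X → ℝ) : Prop where
  measurable : Measurable E
  nonneg : ∀ x, 0 ≤ E x
  integrable : Integrable E μ
  integrable_klFun : Integrable (fun x => r x * klFun (E x / r x)) μ

lemma IsPosDensity.mul_klFun_div_le {q E r : X → ℝ} (hr : IsPosDensity μ r)
    (hqE : ∀ x, q x ∈ Set.Icc 0 (E x)) :
    ∀ᵐ x ∂μ, r x * klFun (q x / r x) ≤ r x + r x * klFun (E x / r x) := by
  filter_upwards [hr.pos] with x hx
  have := klFun_le_one_add (div_nonneg (hqE x).1 hx.le)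
    (div_le_div_of_nonneg_right (hqE x).2 hx.le)
  nlinarith

lemma IsPosDensity.ae_mul_klFun_nonneg {q r : X → ℝ} (hr : IsPosDensity μ r)
    (hq : ∀ x, 0 ≤ q x) : ∀ᵐ x ∂μ, 0 ≤ r x * klFun (q x / r x) := by
  filter_upwards [hr.pos] with x hx
  exact mul_nonneg hx.le (klFun_nonneg (div_nonneg (hq x) hx.le))

lemma IsPosDensity.measurable_mul_klFun {q r : X → ℝ} (hr : IsPosDensity μ r)
    (hq : Measurable q) : Measurable fun x => r x * klFun (q x / r x) :=
  hr.measurable.mul (measurable_klFun.comp (hq.div hr.measurable))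

lemma IsPosDensity.isEnvelope {q r : X → ℝ} (hr : IsPosDensity μ r) (hq : Measurable q)
    (hq0 : ∀ x, 0 ≤ q x) (hqi : Integrable q μ) (hkl : klDens μ q r ≠ ∞) : IsEnvelope μ r q :=
  ⟨hq, hq0, hqi, (lintegral_ofReal_ne_top_iff_integrable
    (hr.measurable_mul_klFun hq).aestronglyMeasurable (hr.ae_mul_klFun_nonneg hq0)).1 hkl⟩

lemma IsPosDensity.isEnvelope_self {r : X → ℝ} (hr : IsPosDensity μ r) (hr0 : ∀ x, 0 ≤ r x) :
    IsEnvelope μ r r :=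
  ⟨hr.measurable, hr0, hr.integrable, (integrable_zero _ _ _).congr <| by
    filter_upwards [hr.pos] with x hx
    simp only [div_self hx.ne', klFun_one, mul_zero]
    rfl⟩

variable {r E : X → ℝ}

lemma IsEnvelope.mono (hE : IsEnvelope μ r E) (hr : IsPosDensity μ r) {q : X → ℝ}
    (hq : Measurable q) (hqE : ∀ x, q x ∈ Set.Icc 0 (E x)) : IsEnvelope μ r q where
  measurable := hq
  nonneg x := (hqE x).1
  integrable := hE.integrable.mono' hq.aestronglyMeasurable <| Eventually.of_forall fun x => by
    rw [Real.norm_of_nonneg (hqE x).1]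
    exact (hqE x).2
  integrable_klFun := (hr.integrable.add hE.integrable_klFun).mono'
    (hr.measurable_mul_klFun hq).aestronglyMeasurable <| by
      filter_upwards [hr.mul_klFun_div_le hqE, hr.ae_mul_klFun_nonneg fun x => (hqE x).1]
        with x hle h0
      rwa [Real.norm_of_nonneg h0]

lemma IsEnvelope.const_mul (hE : IsEnvelope μ r E) (hr : IsPosDensity μ r) {c : ℝ} (hc : 0 ≤ c) :
    IsEnvelope μ r fun x => c * E x where
  measurable := hE.measurable.const_mul c
  nonneg x := mul_nonneg hc (hE.nonneg x)
  integrable := hE.integrable.const_mul c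
  integrable_klFun :=
    (((hE.integrable_klFun.const_mul c).add (hE.integrable.const_mul (c * |Real.log c|))).add
      hr.integrable).mono'
      (hr.measurable_mul_klFun (hE.measurable.const_mul c)).aestronglyMeasurable <| by
        filter_upwards [hr.pos, hr.ae_mul_klFun_nonneg fun x => mul_nonneg hc (hE.nonneg x)]
          with x hx h0
        have hle := mul_le_mul_of_nonneg_left (klFun_mul_le hc (div_nonneg (hE.nonneg x) hx.le))
          hx.le
        rw [← mul_div_assoc] at hle
        rw [Real.norm_of_nonneg h0]
        refine hle.trans_eq ?_
        simp only [Pi.add_apply]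
        field_simp

variable {ι : Type*} {l : Filter ι} [l.IsCountablyGenerated] {q : ι → X → ℝ} {h : X → ℝ}

lemma IsEnvelope.tendsto_klDens (hE : IsEnvelope μ r E) (hr : IsPosDensity μ r)
    (hq : ∀ k, Measurable (q k)) (hqE : ∀ᶠ k in l, ∀ x, q k x ∈ Set.Icc 0 (E x))
    (hlim : ∀ᵐ x ∂μ, Tendsto (fun k => q k x) l (𝓝 (h x))) :
    Tendsto (fun k => klDens μ (q k) r) l (𝓝 (klDens μ h r)) := by
  refine tendsto_lintegral_filter_of_dominated_convergence
    (fun x => ENNReal.ofReal (r x + r x * klFun (E x / r x)))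
    (Eventually.of_forall fun k => (hr.measurable_mul_klFun (hq k)).ennreal_ofReal) ?_
    (hr.integrable.add hE.integrable_klFun).lintegral_lt_top.ne ?_
  · filter_upwards [hqE] with k hk
    filter_upwards [hr.mul_klFun_div_le hk] with x hx using ENNReal.ofReal_le_ofReal hx
  · filter_upwards [hlim] with x hx
    exact (ENNReal.continuous_ofReal.tendsto _).comp
      (((continuous_klFun.tendsto _).comp (hx.div_const _)).const_mul _)

lemma IsEnvelope.tendsto_integral (hE : IsEnvelope μ r E)
    (hq : ∀ k, Measurable (q k)) (hqE : ∀ k x, q k x ∈ Set.Icc 0 (E x))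
    (hlim : ∀ᵐ x ∂μ, Tendsto (fun k => q k x) l (𝓝 (h x))) :
    Tendsto (fun k => ∫ x, q k x ∂μ) l (𝓝 (∫ x, h x ∂μ)) :=
  tendsto_integral_filter_of_dominated_convergence E
    (Eventually.of_forall fun k => (hq k).aestronglyMeasurable)
    (Eventually.of_forall fun k => Eventually.of_forall fun x => by
      rw [Real.norm_of_nonneg (hqE k x).1]
      exact (hqE k x).2) hE.integrable hlim

/-- The function `q` rescaled to a probability density; junk (zero) if `∫ q = 0`. -/
noncomputable def normalized (μ : Measure X) (q : X → ℝ) (x : X) : ℝ := q x / ∫ y, q y ∂μ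

lemma IsEnvelope.tendsto_klDens_normalized (hE : IsEnvelope μ r E) (hr : IsPosDensity μ r)
    (hq : ∀ k, Measurable (q k)) (hqE : ∀ k x, q k x ∈ Set.Icc 0 (E x))
    (hlim : ∀ᵐ x ∂μ, Tendsto (fun k => q k x) l (𝓝 (h x))) (hh : 0 < ∫ x, h x ∂μ) :
    Tendsto (fun k => klDens μ (normalized μ (q k)) r) l (𝓝 (klDens μ (normalized μ h) r)) := by
  have hint := hE.tendsto_integral hq hqE hlim
  refine (hE.const_mul hr (c := 2 / ∫ x, h x ∂μ) (by positivity)).tendsto_klDens hr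
    (fun k => (hq k).div_const _) ?_ ?_
  · filter_upwards [hint.eventually_const_lt (half_lt_self hh)] with k hk x
    have hk0 := (half_pos hh).trans hk
    refine ⟨div_nonneg (hqE k x).1 hk0.le, ?_⟩
    calc q k x / ∫ y, q k y ∂μ ≤ E x / ((∫ y, h y ∂μ) / 2) :=
          div_le_div₀ (hE.nonneg x) (hqE k x).2 (half_pos hh) hk.le
      _ = 2 / (∫ y, h y ∂μ) * E x := by field_simp
  · filter_upwards [hlim] with x hx using hx.div hint hh.ne'

end KLDens

/-! ### Gaussian mixtures -/

section Gaussian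

variable {d : ℕ}

/-- The centred Gaussian profile `exp (-b ‖θ‖²)`, the envelope used for all density families. -/
noncomputable def expNegSq (b : ℝ) (θ : Vec d) : ℝ := Real.exp (-b * ‖θ‖ ^ 2)

lemma expNegSq_pos (b : ℝ) (θ : Vec d) : 0 < expNegSq b θ := Real.exp_pos _

lemma continuous_expNegSq (b : ℝ) : Continuous (expNegSq b : Vec d → ℝ) := by
  unfold expNegSq
  fun_prop

lemma expNegSq_anti {b c : ℝ} (hbc : b ≤ c) (θ : Vec d) : expNegSq c θ ≤ expNegSq b θ := by
  unfold expNegSq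
  gcongr

lemma expNegSq_mul_expNegSq (b c : ℝ) (θ : Vec d) :
    expNegSq b θ * expNegSq c θ = expNegSq (b + c) θ := by
  rw [expNegSq, expNegSq, expNegSq, ← Real.exp_add]
  ring_nf

lemma integrable_expNegSq {b : ℝ} (hb : 0 < b) : Integrable (expNegSq b : Vec d → ℝ) := by
  have h := (GaussianFourier.integrable_cexp_neg_mul_sq_norm_add (V := Vec d) (b := (b : ℂ))
    (by simpa using hb) 0 0).norm
  refine h.congr (Eventually.of_forall fun θ => ?_)
  simp [expNegSq, Complex.norm_exp, ← Complex.ofReal_pow]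

lemma expNegSq_two_mul_sub_le {b : ℝ} (hb : 0 ≤ b) (θ x : Vec d) :
    expNegSq (2 * b) (θ - x) ≤ expNegSq (-(2 * b)) x * expNegSq b θ := by
  have hnorm : ‖θ‖ ^ 2 ≤ 2 * ‖θ - x‖ ^ 2 + 2 * ‖x‖ ^ 2 := by
    have htri := norm_add_le (θ - x) x
    rw [sub_add_cancel] at htri
    nlinarith [norm_nonneg θ, sq_nonneg (‖θ - x‖ - ‖x‖)]
  rw [expNegSq, expNegSq, expNegSq, ← Real.exp_add, Real.exp_le_exp]
  linarith [mul_le_mul_of_nonneg_left hnorm hb]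

lemma gaussDens_pos {σ : ℝ} (hσ : 0 < σ) (t : Vec d) : 0 < gaussDens σ t := by
  unfold gaussDens
  positivity

lemma continuous_gaussDens (σ : ℝ) : Continuous (gaussDens σ : Vec d → ℝ) := by
  unfold gaussDens
  fun_prop

lemma gaussDens_eq (σ : ℝ) (t : Vec d) :
    gaussDens σ t = gaussDens σ (0 : Vec d) * expNegSq (2 * σ ^ 2)⁻¹ t := by
  simp only [gaussDens, expNegSq, norm_zero, ne_eq, OfNat.ofNat_ne_zero, not_false_eq_true,
    zero_pow, neg_zero, zero_div, Real.exp_zero, mul_one]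
  congr 2
  ring

lemma gaussDens_sub_le {σ : ℝ} (hσ : 0 < σ) (θ x : Vec d) :
    gaussDens σ (θ - x) ≤
      gaussDens σ (0 : Vec d) * expNegSq (-(2 * σ ^ 2)⁻¹) x * expNegSq (4 * σ ^ 2)⁻¹ θ := by
  have hle := expNegSq_two_mul_sub_le (b := (4 * σ ^ 2)⁻¹) (by positivity) θ x
  rw [show 2 * (4 * σ ^ 2)⁻¹ = (2 * σ ^ 2)⁻¹ by field_simp; norm_num] at hle
  rw [gaussDens_eq, mul_assoc]
  exact mul_le_mul_of_nonneg_left hle (gaussDens_pos hσ 0).le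

lemma expNegSq_le_gaussDens_sub {σ : ℝ} (hσ : 0 < σ) (θ x : Vec d) :
    expNegSq (σ ^ 2)⁻¹ θ ≤
      (gaussDens σ (0 : Vec d))⁻¹ * expNegSq (-(σ ^ 2)⁻¹) x * gaussDens σ (θ - x) := by
  have hle := expNegSq_two_mul_sub_le (b := (2 * σ ^ 2)⁻¹) (by positivity) (θ - x) (-x)
  rw [show 2 * (2 * σ ^ 2)⁻¹ = (σ ^ 2)⁻¹ by field_simp, sub_neg_eq_add, sub_add_cancel] at hle
  have hpos := gaussDens_pos hσ (0 : Vec d)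
  rw [gaussDens_eq σ (θ - x)]
  calc expNegSq (σ ^ 2)⁻¹ θ ≤ _ := hle
    _ = _ := by
      simp only [expNegSq, norm_neg]
      field_simp

lemma integrable_gaussDens {σ : ℝ} (hσ : 0 < σ) : Integrable (gaussDens σ : Vec d → ℝ) :=
  ((integrable_expNegSq (by positivity)).const_mul _).congr
    (Eventually.of_forall fun t => (gaussDens_eq σ t).symm)

lemma integral_gaussDens {σ : ℝ} (hσ : 0 < σ) : ∫ t : Vec d, gaussDens σ t = 1 := by
  have hexp : ∀ t : Vec d, gaussDens σ t =
      (Real.sqrt (2 * Real.pi * σ ^ 2))⁻¹ ^ d * Real.exp (-(2 * σ ^ 2)⁻¹ * ‖t‖ ^ 2) := fun t => by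
    rw [gaussDens, neg_div, neg_mul, ← div_eq_inv_mul]
  have hvar : Real.pi / (2 * σ ^ 2)⁻¹ = 2 * Real.pi * σ ^ 2 := by field_simp
  simp_rw [hexp]
  rw [integral_const_mul, GaussianFourier.integral_rexp_neg_mul_sq_norm (by positivity),
    finrank_euclideanSpace_fin, hvar, inv_pow, Real.sqrt_eq_rpow, ← Real.rpow_natCast,
    ← Real.rpow_mul (by positivity), show (1 / 2 : ℝ) * d = d / 2 by ring,
    inv_mul_cancel₀ (by positivity)]

lemma lintegral_gaussDens_sub {σ : ℝ} (hσ : 0 < σ) (x : Vec d) :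
    ∫⁻ θ, ENNReal.ofReal (gaussDens σ (θ - x)) = 1 := by
  rw [lintegral_sub_right_eq_self (fun θ => ENNReal.ofReal (gaussDens σ θ)) x,
    ← ofReal_integral_eq_lintegral_ofReal (integrable_gaussDens hσ)
      (Eventually.of_forall fun _ => (gaussDens_pos hσ _).le), integral_gaussDens hσ,
    ENNReal.ofReal_one]

lemma pow_mul_gaussDens_smul {σ : ℝ} (hσ : 0 < σ) (z : Vec d) :
    σ ^ d * gaussDens σ (σ • z) = gaussDens 1 z := by
  have hexp : -(σ * ‖z‖) ^ 2 / (2 * σ ^ 2) = -‖z‖ ^ 2 / (2 * 1 ^ 2) := by field_simp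
  have hpow : σ ^ d * σ⁻¹ ^ d = 1 := by rw [← mul_pow, mul_inv_cancel₀ hσ.ne', one_pow]
  rw [gaussDens, gaussDens, Real.sqrt_mul (by positivity), Real.sqrt_sq hσ.le, norm_smul, mul_inv,
    mul_pow, Real.norm_of_nonneg hσ.le, hexp]
  simp only [one_pow, mul_one]
  linear_combination ((Real.sqrt (2 * Real.pi))⁻¹ ^ d * Real.exp (-‖z‖ ^ 2 / 2)) * hpow

lemma integral_gaussDens_sub_mul {σ : ℝ} (hσ : 0 < σ) (G : Vec d → ℝ) (θ : Vec d) :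
    ∫ x, gaussDens σ (θ - x) * G x = ∫ z, G (θ - σ • z) * gaussDens 1 z := by
  have hsmul := Measure.integral_comp_smul (volume : Measure (Vec d))
    (fun y => gaussDens σ y * G (θ - y)) σ
  rw [finrank_euclideanSpace_fin, abs_of_pos (by positivity), smul_eq_mul,
    eq_inv_mul_iff_mul_eq₀ (by positivity), ← integral_const_mul] at hsmul
  rw [← integral_sub_left_eq_self (fun x => gaussDens σ (θ - x) * G x) volume θ]
  simp_rw [sub_sub_cancel]
  rw [← hsmul]
  congr 1 with z
  rw [← pow_mul_gaussDens_smul hσ z]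
  ring

/-- The density of the mixture `∫ N(x, σ² I_d) dP(x)`. -/
noncomputable def gaussMix (P : Measure (Vec d)) (σ : ℝ) (θ : Vec d) : ℝ :=
  ∫ x, gaussDens σ (θ - x) ∂P

lemma gaussMix_densMeasure {G : Vec d → ℝ} (hG : Measurable G) (hG0 : ∀ x, 0 ≤ G x) {σ : ℝ}
    (hσ : 0 < σ) (θ : Vec d) :
    gaussMix (densMeasure G) σ θ = ∫ z, G (θ - σ • z) * gaussDens 1 z := by
  rw [← integral_gaussDens_sub_mul hσ, gaussMix, densMeasure,
    integral_withDensity_eq_integral_toReal_smul hG.ennreal_ofReal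
      (Eventually.of_forall fun _ => ENNReal.ofReal_lt_top)]
  simp only [ENNReal.toReal_ofReal (hG0 _), smul_eq_mul, mul_comm]

end Gaussian

section GPDens

variable {d : ℕ} (μ : C(unitInterval, Vec d))

lemma continuous_gaussDens_sub (σ : ℝ) :
    Continuous fun z : Vec d × unitInterval => gaussDens σ (z.1 - μ z.2) :=
  (continuous_gaussDens σ).comp (continuous_fst.sub (μ.continuous.comp continuous_snd))

lemma integrable_gaussDens_sub (σ : ℝ) (θ : Vec d) : Integrable fun η => gaussDens σ (θ - μ η) :=
  ((continuous_gaussDens_sub μ σ).comp (by fun_prop : Continuous fun η => (θ, η))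
    ).integrable_of_hasCompactSupport (HasCompactSupport.of_compactSpace _)

lemma measurable_gpDens (σ : ℝ) : Measurable (gpDens μ σ) :=
  (continuous_gaussDens_sub μ σ).stronglyMeasurable.integral_prod_right'.measurable

lemma gpDens_nonneg {σ : ℝ} (hσ : 0 < σ) (θ : Vec d) : 0 ≤ gpDens μ σ θ :=
  integral_nonneg fun _ => (gaussDens_pos hσ _).le

lemma lintegral_gpDens {σ : ℝ} (hσ : 0 < σ) : ∫⁻ θ, ENNReal.ofReal (gpDens μ σ θ) = 1 := by
  have hmix : ∀ θ, ENNReal.ofReal (gpDens μ σ θ) =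
      ∫⁻ η, ENNReal.ofReal (gaussDens σ (θ - μ η)) := fun θ =>
    ofReal_integral_eq_lintegral_ofReal (integrable_gaussDens_sub μ σ θ)
      (Eventually.of_forall fun _ => (gaussDens_pos hσ _).le)
  simp_rw [hmix]
  rw [lintegral_lintegral_swap
    (continuous_gaussDens_sub μ σ).measurable.ennreal_ofReal.aemeasurable]
  simp only [lintegral_gaussDens_sub hσ, lintegral_one, measure_univ]

lemma integrable_gpDens {σ : ℝ} (hσ : 0 < σ) : Integrable (gpDens μ σ) :=
  (lintegral_ofReal_ne_top_iff_integrable (measurable_gpDens μ σ).aestronglyMeasurable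
    (Eventually.of_forall (gpDens_nonneg μ hσ))).1 (by simp [lintegral_gpDens μ hσ])

variable {μ}

lemma gpDens_le {σ R : ℝ} (hσ : 0 < σ) (hR : ∀ η, ‖μ η‖ ≤ R) (θ : Vec d) :
    gpDens μ σ θ ≤
      gaussDens σ (0 : Vec d) * Real.exp ((2 * σ ^ 2)⁻¹ * R ^ 2) * expNegSq (4 * σ ^ 2)⁻¹ θ := by
  have hle : ∀ η, gaussDens σ (θ - μ η) ≤
      gaussDens σ (0 : Vec d) * Real.exp ((2 * σ ^ 2)⁻¹ * R ^ 2) * expNegSq (4 * σ ^ 2)⁻¹ θ := by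
    intro η
    refine (gaussDens_sub_le hσ θ (μ η)).trans ?_
    have := (gaussDens_pos hσ (0 : Vec d)).le
    have := (expNegSq_pos (4 * σ ^ 2)⁻¹ θ).le
    rw [expNegSq, neg_neg]
    gcongr
    exact hR η
  simpa [gpDens] using integral_mono (μ := (volume : Measure unitInterval))
    (integrable_gaussDens_sub μ σ θ) (integrable_const _) hle

variable (μ)

lemma exists_expNegSq_le_gpDens {σ : ℝ} (hσ : 0 < σ) :
    ∃ C, 0 ≤ C ∧ ∀ θ, expNegSq (σ ^ 2)⁻¹ θ ≤ C * gpDens μ σ θ := by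
  obtain ⟨R, hR⟩ := isCompact_univ.exists_bound_of_continuousOn μ.continuous.continuousOn
  have hpos := gaussDens_pos hσ (0 : Vec d)
  refine ⟨(gaussDens σ (0 : Vec d))⁻¹ * Real.exp ((σ ^ 2)⁻¹ * R ^ 2), by positivity, fun θ => ?_⟩
  have hle : ∀ η, expNegSq (σ ^ 2)⁻¹ θ ≤
      (gaussDens σ (0 : Vec d))⁻¹ * Real.exp ((σ ^ 2)⁻¹ * R ^ 2) * gaussDens σ (θ - μ η) := by
    intro η
    refine (expNegSq_le_gaussDens_sub hσ θ (μ η)).trans ?_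
    have := (gaussDens_pos hσ (θ - μ η)).le
    rw [expNegSq, neg_neg]
    gcongr
    exact hR η (Set.mem_univ η)
  simpa [gpDens, integral_const_mul] using integral_mono (μ := (volume : Measure unitInterval))
    (integrable_const _) ((integrable_gaussDens_sub μ σ θ).const_mul _) hle

lemma gpDens_pos {σ : ℝ} (hσ : 0 < σ) (θ : Vec d) : 0 < gpDens μ σ θ := by
  obtain ⟨C, hC, hle⟩ := exists_expNegSq_le_gpDens μ hσ
  exact pos_of_mul_pos_right ((expNegSq_pos _ θ).trans_le (hle θ)) hC

end GPDens

/-! ### Density of the GP-IVI family in Kullback-Leibler divergence -/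

lemma exists_seq_continuous_tendsto_ae {X E : Type*} [TopologicalSpace X] [MeasurableSpace X]
    [BorelSpace X] [NormalSpace X] [R1Space X] [WeaklyLocallyCompactSpace X]
    [NormedAddCommGroup E] [NormedSpace ℝ E] {μ : Measure X} [μ.Regular] {f : X → E}
    (hf : Integrable f μ) : ∃ g : ℕ → X → E, (∀ k, Continuous (g k)) ∧
      (∀ k, HasCompactSupport (g k)) ∧ ∀ᵐ x ∂μ, Tendsto (fun k => g k x) atTop (𝓝 (f x)) := by
  have happrox : ∀ k : ℕ, ∃ g : X → E, HasCompactSupport g ∧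
      eLpNorm (f - g) 1 μ ≤ ENNReal.ofReal (1 / (k + 1)) ∧ Continuous g ∧ MemLp g 1 μ := fun k =>
    (memLp_one_iff_integrable.2 hf).exists_hasCompactSupport_eLpNorm_sub_le ENNReal.one_ne_top
      (ENNReal.ofReal_pos.2 Nat.one_div_pos_of_nat).ne'
  choose g hgs hg hgc hgm using happrox
  have hbound : Tendsto (fun k : ℕ => ENNReal.ofReal (1 / ((k : ℝ) + 1))) atTop (𝓝 0) := by
    simpa only [ENNReal.ofReal_zero] using
      ENNReal.tendsto_ofReal (tendsto_one_div_add_atTop_nhds_zero_nat (𝕜 := ℝ))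
  have hlim : Tendsto (fun k => eLpNorm (g k - f) 1 μ) atTop (𝓝 0) :=
    tendsto_of_tendsto_of_tendsto_of_le_of_le tendsto_const_nhds hbound (fun _ => zero_le)
      fun k => (eLpNorm_sub_comm _ _ _ _).trans_le (hg k)
  obtain ⟨ns, -, hns⟩ :=
    (tendstoInMeasure_of_tendsto_eLpNorm one_ne_zero (fun k => (hgm k).1) hf.1
      hlim).exists_seq_tendsto_ae
  exact ⟨fun k => g (ns k), fun k => hgc _, fun k => hgs _, hns⟩

lemma exists_continuous_retraction_closedBall {E : Type*} [NormedAddCommGroup E] [NormedSpace ℝ E]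
    {R : ℝ} (hR : 0 < R) :
    ∃ ρ : E → E, Continuous ρ ∧ (∀ x, ‖ρ x‖ ≤ R) ∧ ∀ x, ‖x‖ ≤ R → ρ x = x := by
  have hpos : ∀ x : E, 0 < max R ‖x‖ := fun x => lt_max_of_lt_left hR
  refine ⟨fun x => (R / max R ‖x‖) • x, ?_, fun x => ?_, fun x hx => ?_⟩
  · exact (continuous_const.div (by fun_prop) fun x => (hpos x).ne').smul continuous_id
  · rw [norm_smul, Real.norm_of_nonneg (div_nonneg hR.le (hpos x).le), div_mul_eq_mul_div,
      div_le_iff₀ (hpos x)]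
    gcongr
    exact le_max_right _ _
  · simp only [max_eq_left hx, div_self hR.ne', one_smul]

lemma exists_seq_path_tendsto {E : Type*} [NormedAddCommGroup E] [NormedSpace ℝ E]
    [MeasurableSpace E] [BorelSpace E] [SecondCountableTopology E] [CompleteSpace E] {R : ℝ}
    (hR : 0 < R) (P : Measure E) [IsProbabilityMeasure P] (hP : ∀ᵐ x ∂P, ‖x‖ ≤ R) :
    ∃ (μ : ℕ → C(unitInterval, E)) (X : unitInterval → E), Measurable X ∧
      Measure.map X volume = P ∧ (∀ k η, ‖μ k η‖ ≤ R) ∧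
      ∀ᵐ η, Tendsto (fun k => μ k η) atTop (𝓝 (X η)) := by
  obtain ⟨X, hXm, hX⟩ := Measure.exists_measurable_map_eq P
  have hXR : ∀ᵐ η, ‖X η‖ ≤ R := ae_of_ae_map hXm.aemeasurable (hX ▸ hP)
  have hXi : Integrable X := (integrable_const R).mono' hXm.aestronglyMeasurable hXR
  obtain ⟨g, hgc, -, hg⟩ := exists_seq_continuous_tendsto_ae hXi
  obtain ⟨ρ, hρc, hρR, hρ⟩ := exists_continuous_retraction_closedBall (E := E) hR
  refine ⟨fun k => ⟨fun η => ρ (g k η), hρc.comp (hgc k)⟩, X, hXm, hX, fun k η => hρR _, ?_⟩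
  filter_upwards [hg, hXR] with η hη hηR
  have hlim := (hρc.tendsto (X η)).comp hη
  rwa [hρ _ hηR] at hlim

section Approximation

variable {d : ℕ} {r : Vec d → ℝ} {b : ℝ}

lemma exists_seq_gpDens_tendsto_gaussMix {R : ℝ} (hR : 0 < R) (P : Measure (Vec d))
    [IsProbabilityMeasure P] (hP : ∀ᵐ x ∂P, ‖x‖ ≤ R) {σ : ℝ} (hσ : 0 < σ) :
    ∃ μ : ℕ → C(unitInterval, Vec d), (∀ k η, ‖μ k η‖ ≤ R) ∧
      ∀ θ, Tendsto (fun k => gpDens (μ k) σ θ) atTop (𝓝 (gaussMix P σ θ)) := by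
  obtain ⟨μ, X, hXm, hX, hμR, hμ⟩ := exists_seq_path_tendsto hR P hP
  refine ⟨μ, hμR, fun θ => ?_⟩
  have hcont : Continuous fun x => gaussDens σ (θ - x) :=
    (continuous_gaussDens σ).comp (by fun_prop)
  rw [gaussMix, ← hX, integral_map hXm.aemeasurable hcont.aestronglyMeasurable]
  refine tendsto_integral_of_dominated_convergence (fun _ => gaussDens σ (0 : Vec d))
    (fun k => (integrable_gaussDens_sub (μ k) σ θ).1) (integrable_const _)
    (fun k => Eventually.of_forall fun η => ?_) ?_
  · rw [Real.norm_of_nonneg (gaussDens_pos hσ _).le, gaussDens_eq]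
    exact mul_le_of_le_one_right (gaussDens_pos hσ _).le
      (Real.exp_le_one_iff.2 (by rw [neg_mul, neg_nonpos]; positivity))
  · filter_upwards [hμ] with η hη using (hcont.tendsto _).comp hη

lemma iInf_gpFamily_le_klDens_gaussMix (hr : IsPosDensity volume r) {σ : ℝ} (hσ : 0 < σ)
    (hE : IsEnvelope volume r (expNegSq (4 * σ ^ 2)⁻¹)) {R : ℝ} (hR : 0 < R) (P : Measure (Vec d))
    [IsProbabilityMeasure P] (hP : ∀ᵐ x ∂P, ‖x‖ ≤ R) :
    ⨅ q ∈ gpFamily d, klDens volume q r ≤ klDens volume (gaussMix P σ) r := by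
  obtain ⟨μ, hμR, hμ⟩ := exists_seq_gpDens_tendsto_gaussMix hR P hP hσ
  have hc := mul_nonneg (gaussDens_pos hσ (0 : Vec d)).le
    (Real.exp_pos ((2 * σ ^ 2)⁻¹ * R ^ 2)).le
  exact ge_of_tendsto' ((hE.const_mul hr hc).tendsto_klDens hr (fun k => measurable_gpDens (μ k) σ)
    (Eventually.of_forall fun k θ => ⟨gpDens_nonneg _ hσ θ, gpDens_le hσ (hμR k) θ⟩)
    (Eventually.of_forall hμ)) fun k => iInf₂_le _ ⟨μ k, σ, hσ, rfl⟩

lemma exists_le_mul_expNegSq {G : Vec d → ℝ} (hGc : Continuous G) (hGs : HasCompactSupport G)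
    (b : ℝ) : ∃ M, 0 ≤ M ∧ ∀ θ, G θ ≤ M * expNegSq b θ := by
  obtain ⟨M, hM⟩ := (hGs.mul_right (f' := expNegSq (-b))).exists_bound_of_continuous
    (hGc.mul (continuous_expNegSq (-b)))
  refine ⟨M, (norm_nonneg _).trans (hM 0), fun θ => ?_⟩
  calc G θ = (G θ * expNegSq (-b) θ) * expNegSq b θ := by
        rw [mul_assoc, expNegSq_mul_expNegSq, neg_add_cancel, expNegSq, neg_zero, zero_mul,
          Real.exp_zero, mul_one]
    _ ≤ M * expNegSq b θ := by
        have := (expNegSq_pos b θ).le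
        gcongr
        exact (le_abs_self _).trans (hM θ)

lemma measurable_gaussMix (P : Measure (Vec d)) [SFinite P] (σ : ℝ) : Measurable (gaussMix P σ) :=
  ((continuous_gaussDens σ).comp (by fun_prop : Continuous fun z : Vec d × Vec d => z.1 - z.2)
    ).stronglyMeasurable.integral_prod_right'.measurable

lemma gaussMix_densMeasure_le {G : Vec d → ℝ} (hG : Measurable G) (hG0 : ∀ x, 0 ≤ G x) {M : ℝ}
    (hb : 0 < b) (hGM : ∀ x, G x ≤ M * expNegSq (2 * b) x) (hM : 0 ≤ M) {σ : ℝ} (hσ : 0 < σ)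
    (hσb : b ≤ (8 * σ ^ 2)⁻¹) (θ : Vec d) :
    gaussMix (densMeasure G) σ θ ≤
      M * (gaussDens 1 (0 : Vec d) * ∫ z : Vec d, expNegSq (1 / 4) z) * expNegSq b θ := by
  have hσb' : 2 * b * σ ^ 2 ≤ 1 / 4 := by
    rw [← one_div, le_div_iff₀ (by positivity)] at hσb
    linarith
  have hle : ∀ z, G (θ - σ • z) * gaussDens 1 z ≤
      M * gaussDens 1 (0 : Vec d) * expNegSq b θ * expNegSq (1 / 4) z := by
    intro z
    have hscale : expNegSq (-(2 * b)) (σ • z) ≤ expNegSq (-(1 / 4)) z := by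
      rw [expNegSq, expNegSq, Real.exp_le_exp, norm_smul, mul_pow, Real.norm_of_nonneg hσ.le]
      nlinarith [sq_nonneg ‖z‖]
    have h0 := (gaussDens_pos one_pos (0 : Vec d)).le
    have hb0 := (expNegSq_pos b θ).le
    have h2 := (expNegSq_pos (2 * 1 ^ 2)⁻¹ z).le
    calc G (θ - σ • z) * gaussDens 1 z
        ≤ M * (expNegSq (-(1 / 4)) z * expNegSq b θ) *
            (gaussDens 1 (0 : Vec d) * expNegSq (2 * 1 ^ 2)⁻¹ z) := by
          rw [gaussDens_eq 1 z]
          gcongr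
          exact (hGM _).trans (by
            gcongr
            exact (expNegSq_two_mul_sub_le hb.le θ (σ • z)).trans (by gcongr))
      _ = M * gaussDens 1 (0 : Vec d) * expNegSq b θ *
            (expNegSq (-(1 / 4)) z * expNegSq (2 * 1 ^ 2)⁻¹ z) := by ring
      _ = _ := by rw [expNegSq_mul_expNegSq]; norm_num
  rw [gaussMix_densMeasure hG hG0 hσ]
  refine (integral_mono_of_nonneg
    (Eventually.of_forall fun z => mul_nonneg (hG0 _) (gaussDens_pos one_pos z).le)
    ((integrable_expNegSq (by norm_num)).const_mul _) (Eventually.of_forall hle)).trans_eq ?_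
  rw [integral_const_mul]
  ring

lemma tendsto_gaussMix_densMeasure {G : Vec d → ℝ} (hGc : Continuous G) (hG0 : ∀ x, 0 ≤ G x)
    {M : ℝ} (hGM : ∀ x, G x ≤ M) (θ : Vec d) :
    Tendsto (fun σ => gaussMix (densMeasure G) σ θ) (𝓝[>] 0) (𝓝 (G θ)) := by
  have hG : G θ = ∫ z : Vec d, G θ * gaussDens 1 z := by
    rw [integral_const_mul, integral_gaussDens one_pos, mul_one]
  have hsubst : ∀ᶠ σ in 𝓝[>] (0 : ℝ),
      ∫ z, G (θ - σ • z) * gaussDens 1 z = gaussMix (densMeasure G) σ θ := by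
    filter_upwards [self_mem_nhdsWithin] with σ hσ
    exact (gaussMix_densMeasure hGc.measurable hG0 hσ θ).symm
  rw [hG]
  refine Tendsto.congr' hsubst <| tendsto_integral_filter_of_dominated_convergence
    (fun z => M * gaussDens 1 z) (Eventually.of_forall fun σ =>
      ((hGc.comp (by fun_prop)).mul (continuous_gaussDens 1)).aestronglyMeasurable)
    (Eventually.of_forall fun σ => Eventually.of_forall fun z => ?_)
    ((integrable_gaussDens one_pos).const_mul M) (Eventually.of_forall fun z => ?_)
  · have hz := (gaussDens_pos one_pos z).le
    rw [Real.norm_of_nonneg (mul_nonneg (hG0 _) hz)]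
    exact mul_le_mul_of_nonneg_right (hGM _) hz
  · have hcont : Continuous fun σ : ℝ => G (θ - σ • z) := hGc.comp (by fun_prop)
    exact ((hcont.tendsto' 0 (G θ) (by rw [zero_smul, sub_zero])).mono_left
      nhdsWithin_le_nhds).mul_const _

lemma IsEnvelope.expNegSq_of_le (hr : IsPosDensity volume r)
    (hE : IsEnvelope volume r (expNegSq b)) {c : ℝ} (hbc : b ≤ c) :
    IsEnvelope volume r (expNegSq c) :=
  hE.mono hr (continuous_expNegSq c).measurable fun θ =>
    ⟨(expNegSq_pos c θ).le, expNegSq_anti hbc θ⟩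

lemma isProbabilityMeasure_densMeasure {q : Vec d → ℝ} (hq : ∫⁻ θ, ENNReal.ofReal (q θ) = 1) :
    IsProbabilityMeasure (densMeasure q) :=
  ⟨by rw [densMeasure, withDensity_apply _ MeasurableSet.univ, setLIntegral_univ, hq]⟩

lemma exists_ae_norm_le_densMeasure {G : Vec d → ℝ} (hGc : Continuous G)
    (hGs : HasCompactSupport G) : ∃ R, 0 < R ∧ ∀ᵐ x ∂(densMeasure G), ‖x‖ ≤ R := by
  obtain ⟨R, hR0, hR⟩ := hGs.isCompact.isBounded.subset_closedBall_lt 0 0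
  refine ⟨R, hR0, (ae_withDensity_iff hGc.measurable.ennreal_ofReal).2 <|
    Eventually.of_forall fun x hx => ?_⟩
  have hne : G x ≠ 0 := fun h => hx (by rw [h, ENNReal.ofReal_zero])
  exact mem_closedBall_zero_iff.1 (hR (subset_tsupport _ hne))

lemma iInf_gpFamily_le_klDens_of_continuous (hr : IsPosDensity volume r) (hb : 0 < b)
    (hE : IsEnvelope volume r (expNegSq b)) {G : Vec d → ℝ} (hGc : Continuous G)
    (hGs : HasCompactSupport G) (hG0 : ∀ θ, 0 ≤ G θ) (hGi : ∫⁻ θ, ENNReal.ofReal (G θ) = 1) :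
    ⨅ q ∈ gpFamily d, klDens volume q r ≤ klDens volume G r := by
  have := isProbabilityMeasure_densMeasure hGi
  obtain ⟨R, hR0, hR⟩ := exists_ae_norm_le_densMeasure hGc hGs
  obtain ⟨M, hM0, hM⟩ := exists_le_mul_expNegSq hGc hGs (2 * b)
  obtain ⟨M', hM'⟩ := hGs.exists_bound_of_continuous hGc
  have hK : 0 ≤ M * (gaussDens 1 (0 : Vec d) * ∫ z : Vec d, expNegSq (1 / 4) z) :=
    mul_nonneg hM0 (mul_nonneg (gaussDens_pos one_pos _).le
      (integral_nonneg fun z => (expNegSq_pos _ z).le))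
  have hsmall : ∀ᶠ σ in 𝓝[>] (0 : ℝ), 0 < σ ∧ b ≤ (8 * σ ^ 2)⁻¹ := by
    have hcont : Continuous fun σ : ℝ => b * (8 * σ ^ 2) := by fun_prop
    filter_upwards [self_mem_nhdsWithin, ((hcont.tendsto' 0 0 (by simp)).mono_left
      nhdsWithin_le_nhds).eventually_le_const one_pos] with σ (hσ : 0 < σ) hσb
    exact ⟨hσ, by rwa [← one_div, le_div_iff₀ (by positivity)]⟩
  refine ge_of_tendsto ((hE.const_mul hr hK).tendsto_klDens hr
    (fun σ => measurable_gaussMix (densMeasure G) σ) ?_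
    (Eventually.of_forall (tendsto_gaussMix_densMeasure hGc hG0
      fun x => (le_abs_self _).trans (hM' x)))) ?_
  · filter_upwards [hsmall] with σ ⟨hσ, hσb⟩ θ
    exact ⟨integral_nonneg fun x => (gaussDens_pos hσ _).le,
      gaussMix_densMeasure_le hGc.measurable hG0 hb hM hM0 hσ hσb θ⟩
  · filter_upwards [hsmall] with σ ⟨hσ, hσb⟩
    have hbσ : b ≤ (4 * σ ^ 2)⁻¹ := hσb.trans (by gcongr; norm_num)
    exact iInf_gpFamily_le_klDens_gaussMix hr hσ (hE.expNegSq_of_le hr hbσ) hR0 (densMeasure G) hR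

lemma integral_normalized {q : Vec d → ℝ} (hq : 0 < ∫ θ, q θ) :
    ∫ θ, normalized volume q θ = 1 := by
  simp only [normalized]
  rw [integral_div, div_self hq.ne']

lemma normalized_nonneg {q : Vec d → ℝ} (hq : ∀ θ, 0 ≤ q θ) (θ : Vec d) :
    0 ≤ normalized volume q θ :=
  div_nonneg (hq θ) (integral_nonneg hq)

lemma iInf_gpFamily_le_klDens_of_le_expNegSq (hr : IsPosDensity volume r) (hb : 0 < b)
    (hE : IsEnvelope volume r (expNegSq b)) {m : Vec d → ℝ} (hm : Measurable m) {k : ℝ}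
    (hmE : ∀ θ, m θ ∈ Set.Icc 0 (k * expNegSq b θ)) (hmi : 0 < ∫ θ, m θ) :
    ⨅ q ∈ gpFamily d, klDens volume q r ≤ klDens volume (normalized volume m) r := by
  have hkE0 : ∀ θ : Vec d, 0 ≤ k * expNegSq b θ := fun θ => (hmE θ).1.trans (hmE θ).2
  have hk : 0 ≤ k := nonneg_of_mul_nonneg_left (hkE0 0) (expNegSq_pos b 0)
  have hkE := hE.const_mul hr hk
  obtain ⟨g, hgc, hgs, hg⟩ := exists_seq_continuous_tendsto_ae (hkE.mono hr hm hmE).integrable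
  let G : ℕ → Vec d → ℝ := fun j θ => min (max (g j θ) 0) (k * expNegSq b θ)
  have hGc : ∀ j, Continuous (G j) := fun j =>
    ((hgc j).max continuous_const).min ((continuous_expNegSq b).const_mul k)
  have hGs : ∀ j, HasCompactSupport (G j) := fun j => (hgs j).mono fun θ hθ hgθ => hθ (by
    simp only [G, hgθ, max_self, min_eq_left (hkE0 θ)])
  have hGE : ∀ j θ, G j θ ∈ Set.Icc 0 (k * expNegSq b θ) := fun j θ =>
    ⟨le_min (le_max_right _ _) (hkE0 θ), min_le_right _ _⟩
  have hGlim : ∀ᵐ θ, Tendsto (fun j => G j θ) atTop (𝓝 (m θ)) := by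
    filter_upwards [hg] with θ hθ
    have hlim := (hθ.max (tendsto_const_nhds (x := (0 : ℝ)))).min
      (tendsto_const_nhds (x := k * expNegSq b θ))
    rwa [max_eq_left (hmE θ).1, min_eq_left (hmE θ).2] at hlim
  refine ge_of_tendsto
    (hkE.tendsto_klDens_normalized hr (fun j => (hGc j).measurable) hGE hGlim hmi) ?_
  filter_upwards [(hkE.tendsto_integral (fun j => (hGc j).measurable) hGE
    hGlim).eventually_const_lt hmi] with j hj
  have hc : Continuous (normalized volume (G j)) := (hGc j).div_const _
  have hs : HasCompactSupport (normalized volume (G j)) := (hGs j).mono fun θ hθ hGθ => hθ (by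
    simp only [normalized, hGθ, zero_div])
  have h0 := normalized_nonneg fun θ => (hGE j θ).1
  refine iInf_gpFamily_le_klDens_of_continuous hr hb hE hc hs h0 ?_
  rw [← ofReal_integral_eq_lintegral_ofReal (hc.integrable_of_hasCompactSupport hs)
    (Eventually.of_forall h0), integral_normalized hj, ENNReal.ofReal_one]

lemma iInf_gpFamily_klDens_eq_zero (hr : IsPosDensity volume r) (hr0 : ∀ θ, 0 ≤ r θ)
    (hri : ∫ θ, r θ = 1) (hb : 0 < b) (hE : IsEnvelope volume r (expNegSq b)) :
    ⨅ q ∈ gpFamily d, klDens volume q r = 0 := by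
  have hself : klDens volume (normalized volume r) r = 0 := by
    refine lintegral_eq_zero_of_ae_eq_zero ?_
    filter_upwards [hr.pos] with θ hθ
    simp only [normalized, hri, div_one, div_self hθ.ne', klFun_one, mul_zero, ENNReal.ofReal_zero]
    rfl
  have hrr := hr.isEnvelope_self hr0
  let m : ℕ → Vec d → ℝ := fun k θ => min (r θ) (k * expNegSq b θ)
  have hm : ∀ k, Measurable (m k) := fun k =>
    hr.measurable.min ((continuous_expNegSq b).measurable.const_mul _)
  have hm0 : ∀ k θ, 0 ≤ m k θ := fun k θ =>
    le_min (hr0 θ) (mul_nonneg k.cast_nonneg (expNegSq_pos b θ).le)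
  have hmr : ∀ k θ, m k θ ∈ Set.Icc 0 (r θ) := fun k θ => ⟨hm0 k θ, min_le_left _ _⟩
  have hmlim : ∀ θ, Tendsto (fun k => m k θ) atTop (𝓝 (r θ)) := fun θ => by
    refine tendsto_const_nhds.congr' ?_
    filter_upwards [(tendsto_natCast_atTop_atTop (R := ℝ)).eventually_ge_atTop
      (r θ / expNegSq b θ)] with k hk
    exact (min_eq_left ((div_le_iff₀ (expNegSq_pos b θ)).1 hk)).symm
  have hlim := hrr.tendsto_klDens_normalized hr hm hmr (Eventually.of_forall hmlim)
    (hri ▸ one_pos)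
  have hmi := hrr.tendsto_integral hm hmr (Eventually.of_forall hmlim)
  rw [hself] at hlim
  refine nonpos_iff_eq_zero.1 (ge_of_tendsto hlim ?_)
  filter_upwards [hmi.eventually_const_lt (hri ▸ one_pos)] with k hk
  exact iInf_gpFamily_le_klDens_of_le_expNegSq hr hb hE (hm k)
    (fun θ => ⟨hm0 k θ, min_le_right _ _⟩) hk

lemma ae_pos_of_gpDens_absolutelyContinuous (hr : Measurable r) (μ : C(unitInterval, Vec d))
    {σ : ℝ} (hσ : 0 < σ) (hac : densMeasure (gpDens μ σ) ≪ densMeasure r) :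
    ∀ᵐ θ, 0 < r θ := by
  have hvol : (volume : Measure (Vec d)) ≪ densMeasure (gpDens μ σ) :=
    withDensity_absolutelyContinuous' (measurable_gpDens μ σ).ennreal_ofReal.aemeasurable
      (Eventually.of_forall fun θ => (ENNReal.ofReal_pos.2 (gpDens_pos μ hσ θ)).ne')
  exact (hvol.trans hac).ae_le <| (ae_withDensity_iff hr.ennreal_ofReal).2 <|
    Eventually.of_forall fun θ hθ => ENNReal.ofReal_pos.1 (pos_iff_ne_zero.2 hθ)

theorem iInf_gpFamily_klDiv_eq_zero (hr : Measurable r) (hr0 : ∀ θ, 0 ≤ r θ)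
    (hri : ∫⁻ θ, ENNReal.ofReal (r θ) = 1) {q : Vec d → ℝ} (hq : q ∈ gpFamily d)
    (hqr : klDiv (densMeasure q) (densMeasure r) ≠ ∞) :
    ⨅ q' ∈ gpFamily d, klDiv (densMeasure q') (densMeasure r) = 0 := by
  obtain ⟨μ, σ, hσ, rfl⟩ := hq
  have hrint : Integrable r := (lintegral_ofReal_ne_top_iff_integrable hr.aestronglyMeasurable
    (Eventually.of_forall hr0)).1 (hri ▸ ENNReal.one_ne_top)
  have hrpos : IsPosDensity volume r := ⟨hr,
    ae_pos_of_gpDens_absolutelyContinuous hr μ hσ (klDiv_ne_top_iff.1 hqr).1, hrint⟩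
  have hkl : ∀ q' ∈ gpFamily d,
      klDiv (densMeasure q') (densMeasure r) = klDens volume q' r := by
    rintro _ ⟨ν, τ, hτ, rfl⟩
    exact hrpos.klDiv_withDensity (measurable_gpDens ν τ) (gpDens_nonneg ν hτ)
      (integrable_gpDens ν hτ)
  have hgp := hrpos.isEnvelope (measurable_gpDens μ σ) (gpDens_nonneg μ hσ)
    (integrable_gpDens μ hσ) (hkl _ ⟨μ, σ, hσ, rfl⟩ ▸ hqr)
  obtain ⟨C, hC, hle⟩ := exists_expNegSq_le_gpDens μ hσ
  have hE : IsEnvelope volume r (expNegSq (σ ^ 2)⁻¹) := (hgp.const_mul hrpos hC).mono hrpos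
    (continuous_expNegSq _).measurable fun θ => ⟨(expNegSq_pos _ θ).le, hle θ⟩
  have hri' : ∫ θ, r θ = 1 := by
    rw [integral_eq_lintegral_of_nonneg_ae (Eventually.of_forall hr0) hr.aestronglyMeasurable,
      hri, ENNReal.toReal_one]
  rw [biInf_congr hkl, iInf_gpFamily_klDens_eq_zero hrpos hr0 hri' (by positivity) hE]

end Approximation

/-! ### Variational minimisers and their risk -/

section Minimisers

variable {d : ℕ}

lemma mem_allDensities {𝒬 : Set (Vec d → ℝ)} (h𝒬 : 𝒬 = gpFamily d ∨ 𝒬 = allDensities d)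
    {q : Vec d → ℝ} (hq : q ∈ 𝒬) : q ∈ allDensities d := by
  rcases h𝒬 with rfl | rfl
  · obtain ⟨μ, σ, hσ, rfl⟩ := hq
    exact ⟨measurable_gpDens μ σ, gpDens_nonneg μ hσ, lintegral_gpDens μ hσ⟩
  · exact hq

lemma iInf_klDiv_eq_zero {𝒬 : Set (Vec d → ℝ)} (h𝒬 : 𝒬 = gpFamily d ∨ 𝒬 = allDensities d)
    {q r : Vec d → ℝ} (hr : r ∈ allDensities d) (hq : q ∈ 𝒬)
    (hqr : klDiv (densMeasure q) (densMeasure r) ≠ ∞) :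
    ⨅ q' ∈ 𝒬, klDiv (densMeasure q') (densMeasure r) = 0 := by
  rcases h𝒬 with rfl | rfl
  · exact iInf_gpFamily_klDiv_eq_zero hr.1 hr.2.1 hr.2.2 hq hqr
  · have := isProbabilityMeasure_densMeasure hr.2.2
    exact nonpos_iff_eq_zero.1 ((iInf₂_le r hr).trans_eq (klDiv_self _))

lemma exists_mem_allDensities_inv_smul_densMeasure_eq {f : Vec d → ℝ} (hf : Measurable f)
    (hf0 : ∀ θ, 0 ≤ f θ) (h0 : densMeasure f Set.univ ≠ 0) (h1 : densMeasure f Set.univ ≠ ∞) :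
    ∃ r ∈ allDensities d, (densMeasure f Set.univ)⁻¹ • densMeasure f = densMeasure r := by
  set Z := densMeasure f Set.univ with hZ
  have hZ0 : 0 ≤ Z⁻¹.toReal := ENNReal.toReal_nonneg
  have heq : Z⁻¹ • densMeasure f = densMeasure fun θ => Z⁻¹.toReal * f θ := by
    rw [densMeasure, densMeasure, ← withDensity_smul _ hf.ennreal_ofReal]
    congr 1 with θ
    rw [Pi.smul_apply, smul_eq_mul, ENNReal.ofReal_mul hZ0,
      ENNReal.ofReal_toReal (ENNReal.inv_ne_top.2 h0)]
  refine ⟨_, ⟨hf.const_mul _, fun θ => mul_nonneg hZ0 (hf0 θ), ?_⟩, heq⟩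
  rw [← setLIntegral_univ, ← withDensity_apply _ MeasurableSet.univ, ← densMeasure, ← heq,
    Measure.smul_apply, smul_eq_mul, ← hZ, ENNReal.inv_mul_cancel h0 h1]

end Minimisers

namespace BayesModel

variable {p d : ℕ} (M : BayesModel p d) {n : ℕ} {α : ℝ} {θ₀ : Vec d}

section Measurability

variable (n α)

@[fun_prop]
lemma measurable_lik_uncurry :
    Measurable fun z : Vec d × (Fin n → Vec p) => M.lik n z.1 z.2 :=
  Finset.measurable_prod _ fun i _ => M.measurable_dens.comp
    (measurable_fst.prodMk ((measurable_pi_apply i).comp measurable_snd))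

@[fun_prop]
lemma measurable_lik (θ : Vec d) : Measurable (M.lik n θ) :=
  (M.measurable_lik_uncurry n).comp measurable_prodMk_left

@[fun_prop]
lemma measurable_lik_left (y : Fin n → Vec p) : Measurable fun θ => M.lik n θ y :=
  (M.measurable_lik_uncurry n).comp measurable_prodMk_right

lemma lik_nonneg (θ : Vec d) (y : Fin n → Vec p) : 0 ≤ M.lik n θ y :=
  Finset.prod_nonneg fun i _ => M.dens_nonneg θ (y i)

lemma measurable_affinity (θ₀ : Vec d) : Measurable fun θ => M.affinity α n θ θ₀ :=
  Measurable.lintegral_prod_right' (f := fun z : Vec d × (Fin n → Vec p) =>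
    ENNReal.ofReal (M.lik n z.1 z.2 ^ α * M.lik n θ₀ z.2 ^ (1 - α))) (by fun_prop)

end Measurability

lemma lintegral_lik {θ : Vec d} (hθ : θ ∈ M.Θ) :
    ∫⁻ y, ENNReal.ofReal (M.lik n θ y) = 1 := by
  have hm : Measurable (M.dens θ) := M.measurable_dens.comp measurable_prodMk_left
  have h0 : 0 ≤ᵐ[volume] M.dens θ := Eventually.of_forall (M.dens_nonneg θ)
  have hint : Integrable (M.dens θ) := (lintegral_ofReal_ne_top_iff_integrable
    hm.aestronglyMeasurable h0).1 (M.lintegral_dens θ hθ ▸ ENNReal.one_ne_top)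
  have hone : ∫ y, M.dens θ y = 1 := by
    rw [integral_eq_lintegral_of_nonneg_ae h0 hm.aestronglyMeasurable, M.lintegral_dens θ hθ,
      ENNReal.toReal_one]
  have hlik : Integrable (M.lik n θ) := Integrable.fintype_prod fun _ => hint
  rw [← ofReal_integral_eq_lintegral_ofReal hlik (Eventually.of_forall (M.lik_nonneg n θ))]
  simp only [lik]
  rw [integral_fintype_prod_volume_eq_prod fun _ : Fin n => M.dens θ]
  simp only [hone, Finset.prod_const_one, ENNReal.ofReal_one]

lemma isProbabilityMeasure_law {θ : Vec d} (hθ : θ ∈ M.Θ) :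
    IsProbabilityMeasure (M.law n θ) :=
  ⟨by rw [law, withDensity_apply _ MeasurableSet.univ, setLIntegral_univ, M.lintegral_lik hθ]⟩

instance isProbabilityMeasure_priorMeasure : IsProbabilityMeasure M.priorMeasure :=
  isProbabilityMeasure_densMeasure M.lintegral_prior

lemma ae_priorMeasure_mem : ∀ᵐ θ ∂M.priorMeasure, θ ∈ M.Θ := by
  refine (ae_withDensity_iff M.measurable_prior.ennreal_ofReal).2 <|
    Eventually.of_forall fun θ hθ => ?_
  contrapose! hθ
  rw [M.prior_eq_zero θ hθ, ENNReal.ofReal_zero]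

lemma affinity_le_one (hα₀ : 0 ≤ α) (hα₁ : α ≤ 1) {θ : Vec d} (hθ : θ ∈ M.Θ) (hθ₀ : θ₀ ∈ M.Θ) :
    M.affinity α n θ θ₀ ≤ 1 := by
  have h1α : 0 ≤ 1 - α := sub_nonneg.2 hα₁
  calc M.affinity α n θ θ₀
      ≤ ∫⁻ y, (ENNReal.ofReal α * ENNReal.ofReal (M.lik n θ y) +
          ENNReal.ofReal (1 - α) * ENNReal.ofReal (M.lik n θ₀ y)) := by
        refine lintegral_mono fun y => ?_
        have hθy := M.lik_nonneg n θ y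
        have hθ₀y := M.lik_nonneg n θ₀ y
        rw [← ENNReal.ofReal_mul hα₀, ← ENNReal.ofReal_mul h1α,
          ← ENNReal.ofReal_add (by positivity) (by positivity)]
        exact ENNReal.ofReal_le_ofReal
          (Real.geom_mean_le_arith_mean2_weighted hα₀ h1α hθy hθ₀y (add_sub_cancel _ _))
    _ = ENNReal.ofReal α + ENNReal.ofReal (1 - α) := by
        rw [lintegral_add_left ((M.measurable_lik n θ).ennreal_ofReal.const_mul _),
          lintegral_const_mul' _ _ ENNReal.ofReal_ne_top,
          lintegral_const_mul' _ _ ENNReal.ofReal_ne_top, M.lintegral_lik hθ, M.lintegral_lik hθ₀,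
          mul_one, mul_one]
    _ = 1 := by rw [← ENNReal.ofReal_add hα₀ h1α, add_sub_cancel, ENNReal.ofReal_one]

lemma fracUnnorm_eq_withDensity (y : Fin n → Vec p) : M.fracUnnorm α n y =
    M.priorMeasure.withDensity fun θ => ENNReal.ofReal (M.lik n θ y ^ α) := by
  rw [priorMeasure, densMeasure, ← withDensity_mul _ M.measurable_prior.ennreal_ofReal
    (by fun_prop), fracUnnorm, densMeasure]
  congr 1 with θ
  rw [Pi.mul_apply, mul_comm, ENNReal.ofReal_mul (M.prior_nonneg θ)]

lemma fracPosterior_absolutelyContinuous (y : Fin n → Vec p) :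
    M.fracPosterior α n y ≪ M.priorMeasure := by
  rw [fracPosterior, fracUnnorm_eq_withDensity]
  exact Measure.smul_absolutelyContinuous.trans (withDensity_absolutelyContinuous _ _)

namespace IsAlphaVBMinimiser

variable {M} {𝒬 : Set (Vec d → ℝ)} {y : Fin n → Vec p} {q : Vec d → ℝ}

lemma exists_fracPosterior_eq_densMeasure (h𝒬 : 𝒬 = gpFamily d ∨ 𝒬 = allDensities d)
    (hq : M.IsAlphaVBMinimiser 𝒬 α n y q) :
    ∃ r ∈ allDensities d, M.fracPosterior α n y = densMeasure r := by
  have := isProbabilityMeasure_densMeasure (mem_allDensities h𝒬 hq.1).2.2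
  have hne : M.fracPosterior α n y ≠ 0 := fun h => hq.2.1 (h ▸ klDiv_zero_right)
  refine exists_mem_allDensities_inv_smul_densMeasure_eq
    (((M.measurable_lik_left n y).pow_const α).mul M.measurable_prior)
    (fun θ => mul_nonneg (Real.rpow_nonneg (M.lik_nonneg n θ y) α) (M.prior_nonneg θ))
    (fun h => hne ?_) fun h => hne ?_
  · rw [fracPosterior, fracUnnorm, Measure.measure_univ_eq_zero.1 h, smul_zero]
  · rw [fracPosterior, fracUnnorm, h, ENNReal.inv_top, zero_smul]

theorem densMeasure_eq_fracPosterior (h𝒬 : 𝒬 = gpFamily d ∨ 𝒬 = allDensities d)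
    (hq : M.IsAlphaVBMinimiser 𝒬 α n y q) : densMeasure q = M.fracPosterior α n y := by
  obtain ⟨r, hr, hpost⟩ := hq.exists_fracPosterior_eq_densMeasure h𝒬
  obtain ⟨hq𝒬, hfin, hmin⟩ := hq
  rw [hpost] at hfin hmin ⊢
  have := isProbabilityMeasure_densMeasure (mem_allDensities h𝒬 hq𝒬).2.2
  have := isProbabilityMeasure_densMeasure hr.2.2
  refine klDiv_eq_zero_iff.1 (nonpos_iff_eq_zero.1 ?_)
  exact (le_iInf₂ hmin).trans_eq (iInf_klDiv_eq_zero h𝒬 hr hq𝒬 hfin)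

end IsAlphaVBMinimiser

-- The tangent line of `log` at `u`, with `1` added to both sides since `log u - 1` can be negative.
lemma one_sub_mul_renyi_add_one_le (hα₁ : α < 1) {θ : Vec d} (hθ : M.affinity α n θ θ₀ ≤ 1) {u : ℝ}
    (hu : 1 ≤ u) : ENNReal.ofReal (1 - α) * M.renyi α n θ θ₀ + 1 ≤
      (ENNReal.ofReal u)⁻¹ * (M.affinity α n θ θ₀)⁻¹ + ENNReal.ofReal (Real.log u) := by
  have hu0 : 0 < u := one_pos.trans_le hu
  rcases eq_or_ne (M.affinity α n θ θ₀) 0 with h0 | h0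
  · rw [h0, ENNReal.inv_zero,
      ENNReal.mul_top (ENNReal.inv_ne_zero.2 ENNReal.ofReal_ne_top), top_add]
    exact le_top
  rw [renyi, if_neg h0]
  have htop := ne_top_of_le_ne_top ENNReal.one_ne_top hθ
  obtain ⟨a, ha⟩ : ∃ a, a = (M.affinity α n θ θ₀).toReal := ⟨_, rfl⟩
  have ha0 : 0 < a := ha ▸ ENNReal.toReal_pos h0 htop
  have ha1 : a ≤ 1 := ha ▸ ENNReal.toReal_le_of_le_ofReal zero_le_one (by simpa using hθ)
  have hlog : -Real.log a + 1 ≤ (u * a)⁻¹ + Real.log u := by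
    have := Real.log_le_sub_one_of_pos (inv_pos.2 (mul_pos hu0 ha0))
    rw [Real.log_inv, Real.log_mul hu0.ne' ha0.ne'] at this
    linarith
  rw [← ENNReal.ofReal_toReal htop, ← ha, ← ENNReal.ofReal_inv_of_pos ha0,
    ← ENNReal.ofReal_inv_of_pos hu0, ← ENNReal.ofReal_mul (sub_nonneg.2 hα₁.le),
    ← ENNReal.ofReal_mul (by positivity), ENNReal.toReal_ofReal ha0.le, ← mul_inv,
    ← ENNReal.ofReal_add (by positivity) (Real.log_nonneg hu), ← ENNReal.ofReal_one,
    show (1 - α) * ((α - 1)⁻¹ * Real.log a) = -Real.log a by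
      rw [← neg_sub, ← mul_assoc, neg_mul, mul_inv_cancel₀ (sub_ne_zero.2 hα₁.ne), neg_one_mul],
    ← ENNReal.ofReal_add (neg_nonneg.2 (Real.log_nonpos ha0.le ha1)) zero_le_one]
  exact ENNReal.ofReal_le_ofReal hlog

lemma one_sub_mul_lintegral_renyi_le (hα₀ : 0 ≤ α) (hα₁ : α < 1) (hθ₀ : θ₀ ∈ M.Θ)
    {ν : Measure (Vec d)} [IsProbabilityMeasure ν] (hν : ∀ᵐ θ ∂ν, θ ∈ M.Θ) {u : ℝ}
    (hu : ∫⁻ θ, (M.affinity α n θ θ₀)⁻¹ ∂ν ≤ ENNReal.ofReal u) :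
    ENNReal.ofReal (1 - α) * ∫⁻ θ, M.renyi α n θ θ₀ ∂ν ≤ ENNReal.ofReal (Real.log u) := by
  have hle : ∀ᵐ θ ∂ν, M.affinity α n θ θ₀ ≤ 1 := hν.mono fun θ hθ =>
    M.affinity_le_one hα₀ hα₁.le hθ hθ₀
  have hu1 : 1 ≤ u := by
    rw [← ENNReal.one_le_ofReal]
    calc (1 : ℝ≥0∞) = ∫⁻ _, 1 ∂ν := by rw [lintegral_const, measure_univ, one_mul]
      _ ≤ ∫⁻ θ, (M.affinity α n θ θ₀)⁻¹ ∂ν :=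
        lintegral_mono_ae (hle.mono fun θ hθ => ENNReal.one_le_inv.2 hθ)
      _ ≤ ENNReal.ofReal u := hu
  have hu0 : ENNReal.ofReal u ≠ 0 := (ENNReal.ofReal_pos.2 (one_pos.trans_le hu1)).ne'
  refine ENNReal.le_of_add_le_add_right ENNReal.one_ne_top ?_
  calc ENNReal.ofReal (1 - α) * ∫⁻ θ, M.renyi α n θ θ₀ ∂ν + 1
      = ∫⁻ θ, (ENNReal.ofReal (1 - α) * M.renyi α n θ θ₀ + 1) ∂ν := by
        rw [lintegral_add_right _ measurable_const, lintegral_const, measure_univ, one_mul,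
          lintegral_const_mul' _ _ ENNReal.ofReal_ne_top]
    _ ≤ ∫⁻ θ, ((ENNReal.ofReal u)⁻¹ * (M.affinity α n θ θ₀)⁻¹ + ENNReal.ofReal (Real.log u)) ∂ν :=
        lintegral_mono_ae (hle.mono fun θ hθ => M.one_sub_mul_renyi_add_one_le hα₁ hθ hu1)
    _ = (ENNReal.ofReal u)⁻¹ * ∫⁻ θ, (M.affinity α n θ θ₀)⁻¹ ∂ν + ENNReal.ofReal (Real.log u) := by
        rw [lintegral_add_right _ measurable_const, lintegral_const, measure_univ, mul_one,
          lintegral_const_mul' _ _ (ENNReal.inv_ne_top.2 hu0)]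
    _ ≤ (ENNReal.ofReal u)⁻¹ * ENNReal.ofReal u + ENNReal.ofReal (Real.log u) := by gcongr
    _ = ENNReal.ofReal (Real.log u) + 1 := by
        rw [ENNReal.inv_mul_cancel hu0 ENNReal.ofReal_ne_top, add_comm]

theorem IsAlphaVBMinimiser.risk_le (hα₀ : 0 ≤ α) (hα₁ : α < 1) (hθ₀ : θ₀ ∈ M.Θ) (hn : 1 ≤ n)
    {𝒬 : Set (Vec d → ℝ)} (h𝒬 : 𝒬 = gpFamily d ∨ 𝒬 = allDensities d) {y : Fin n → Vec p}
    {q : Vec d → ℝ} (hq : M.IsAlphaVBMinimiser 𝒬 α n y q) {u : ℝ}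
    (hu : ∫⁻ θ, (M.affinity α n θ θ₀)⁻¹ ∂(M.fracPosterior α n y) ≤ ENNReal.ofReal u) :
    M.risk α n θ₀ q ≤ ENNReal.ofReal (Real.log u / (n * (1 - α))) := by
  have hprob := isProbabilityMeasure_densMeasure (mem_allDensities h𝒬 hq.1).2.2
  have hα : 0 < 1 - α := sub_pos.2 hα₁
  have hn0 : (0 : ℝ) < n := Nat.cast_pos.2 hn
  have hinv : (n : ℝ≥0∞)⁻¹ ≠ ∞ := ENNReal.inv_ne_top.2 (Nat.cast_ne_zero.2 (by lia))
  rw [risk, hq.densMeasure_eq_fracPosterior h𝒬] at *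
  have hrenyi := M.one_sub_mul_lintegral_renyi_le hα₀ hα₁ hθ₀
    ((M.fracPosterior_absolutelyContinuous y).ae_le M.ae_priorMeasure_mem) hu
  simp only [div_eq_mul_inv (M.renyi α n _ θ₀)]
  rw [lintegral_mul_const' _ _ hinv, ← div_eq_mul_inv, mul_comm (n : ℝ), ← div_div,
    ENNReal.ofReal_div_of_pos hn0, ENNReal.ofReal_div_of_pos hα, ENNReal.ofReal_natCast]
  gcongr
  rwa [ENNReal.le_div_iff_mul_le (Or.inl (ENNReal.ofReal_pos.2 hα).ne')
    (Or.inl ENNReal.ofReal_ne_top), mul_comm]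

end BayesModel

/-! ### Jensen and Chebyshev inequalities for averages -/

section Averages

lemma eLpNorm_two_sq {X : Type*} [MeasurableSpace X] {β : Measure X} {f : X → ℝ} :
    eLpNorm f 2 β ^ 2 = ∫⁻ x, ‖f x‖ₑ ^ 2 ∂β := by
  have h := eLpNorm_nnreal_pow_eq_lintegral (f := f) (μ := β) (p := 2) two_ne_zero
  simpa only [NNReal.coe_ofNat, ENNReal.coe_ofNat, ENNReal.rpow_two] using h

variable {X : Type*} [MeasurableSpace X] {β : Measure X} [IsProbabilityMeasure β] {f : X → ℝ}

lemma ofReal_exp_integral_le (hf : Integrable f β) :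
    ENNReal.ofReal (Real.exp (∫ x, f x ∂β)) ≤ ∫⁻ x, ENNReal.ofReal (Real.exp (f x)) ∂β := by
  have h0 : 0 ≤ᵐ[β] fun x => Real.exp (f x) := Eventually.of_forall fun x => (Real.exp_pos _).le
  rcases eq_or_ne (∫⁻ x, ENNReal.ofReal (Real.exp (f x)) ∂β) ∞ with htop | htop
  · exact htop ▸ le_top
  have hexp : Integrable (fun x => Real.exp (f x)) β :=
    (lintegral_ofReal_ne_top_iff_integrable (Real.continuous_exp.comp_aestronglyMeasurable hf.1)
      h0).1 htop
  rw [← ofReal_integral_eq_lintegral_ofReal hexp h0]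
  exact ENNReal.ofReal_le_ofReal (convexOn_exp.map_integral_le Real.continuous_exp.continuousOn
    isClosed_univ (Eventually.of_forall fun _ => Set.mem_univ _) hf hexp)

lemma sq_enorm_integral_le (hf : AEStronglyMeasurable f β) :
    ‖∫ x, f x ∂β‖ₑ ^ 2 ≤ ∫⁻ x, ‖f x‖ₑ ^ 2 ∂β := by
  rw [← eLpNorm_two_sq]
  gcongr
  calc ‖∫ x, f x ∂β‖ₑ ≤ eLpNorm f 1 β :=
        (enorm_integral_le_lintegral_enorm f).trans_eq eLpNorm_one_eq_lintegral_enorm.symm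
    _ ≤ eLpNorm f 2 β := eLpNorm_le_eLpNorm_of_exponent_le one_le_two hf

lemma evariance_le_lintegral_sq (hf : AEStronglyMeasurable f β) :
    evariance f β ≤ ∫⁻ x, ‖f x‖ₑ ^ 2 ∂β :=
  (evariance_def' hf).trans_le tsub_le_self

end Averages

section Chebyshev

variable {T Y : Type*} [MeasurableSpace T] [MeasurableSpace Y] {β : Measure T} {P : Measure Y}
  [IsProbabilityMeasure β] [IsProbabilityMeasure P] {L : T → Y → ℝ} {t : ℝ}

lemma integrable_uncurry_of_lintegral_sq_le (hL : Measurable (Function.uncurry L))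
    (h2 : ∀ᵐ θ ∂β, ∫⁻ y, ‖L θ y‖ₑ ^ 2 ∂P ≤ ENNReal.ofReal t) :
    Integrable (Function.uncurry L) (β.prod P) := by
  refine MemLp.integrable one_le_two <|
    (evariance_lt_top_iff_memLp hL.aestronglyMeasurable).1 ?_
  calc evariance (Function.uncurry L) (β.prod P)
      ≤ ∫⁻ z, ‖Function.uncurry L z‖ₑ ^ 2 ∂(β.prod P) :=
        evariance_le_lintegral_sq hL.aestronglyMeasurable
    _ = ∫⁻ θ, ∫⁻ y, ‖L θ y‖ₑ ^ 2 ∂P ∂β := lintegral_prod _ (hL.enorm.pow_const 2).aemeasurable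
    _ ≤ ∫⁻ _, ENNReal.ofReal t ∂β := lintegral_mono_ae h2
    _ < ∞ := by
        rw [lintegral_const, measure_univ, mul_one]
        exact ENNReal.ofReal_lt_top

lemma evariance_integral_le (hL : Measurable (Function.uncurry L))
    (h2 : ∀ᵐ θ ∂β, ∫⁻ y, ‖L θ y‖ₑ ^ 2 ∂P ≤ ENNReal.ofReal t) :
    evariance (fun y => ∫ θ, L θ y ∂β) P ≤ ENNReal.ofReal t :=
  calc evariance (fun y => ∫ θ, L θ y ∂β) P
      ≤ ∫⁻ y, ‖∫ θ, L θ y ∂β‖ₑ ^ 2 ∂P :=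
        evariance_le_lintegral_sq hL.stronglyMeasurable.integral_prod_left'.aestronglyMeasurable
    _ ≤ ∫⁻ y, ∫⁻ θ, ‖L θ y‖ₑ ^ 2 ∂β ∂P := lintegral_mono fun y =>
        sq_enorm_integral_le (hL.comp measurable_prodMk_right).aestronglyMeasurable
    _ = ∫⁻ θ, ∫⁻ y, ‖L θ y‖ₑ ^ 2 ∂P ∂β :=
        lintegral_lintegral_swap ((hL.comp measurable_swap).enorm.pow_const 2).aemeasurable
    _ ≤ ∫⁻ _, ENNReal.ofReal t ∂β := lintegral_mono_ae h2
    _ = ENNReal.ofReal t := by rw [lintegral_const, measure_univ, mul_one]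

lemma measure_add_le_integral_le (hL : Measurable (Function.uncurry L)) (ht : 0 ≤ t)
    (h2 : ∀ᵐ θ ∂β, ∫⁻ y, ‖L θ y‖ₑ ^ 2 ∂P ≤ ENNReal.ofReal t)
    (h1 : ∀ᵐ θ ∂β, ∫ y, L θ y ∂P ≤ t) {c : ℝ} (hc : 0 < c) :
    P {y | t + c ≤ ∫ θ, L θ y ∂β} ≤ ENNReal.ofReal (t / c ^ 2) := by
  have hint := integrable_uncurry_of_lintegral_sq_le hL h2
  have hvar := evariance_integral_le hL h2
  have hmem : MemLp (fun y => ∫ θ, L θ y ∂β) 2 P := (evariance_lt_top_iff_memLp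
    hL.stronglyMeasurable.integral_prod_left'.aestronglyMeasurable).1
    (hvar.trans_lt ENNReal.ofReal_lt_top)
  have hmean : ∫ y, ∫ θ, L θ y ∂β ∂P ≤ t :=
    calc ∫ y, ∫ θ, L θ y ∂β ∂P = ∫ θ, ∫ y, L θ y ∂P ∂β := (integral_integral_swap hint).symm
      _ ≤ ∫ _, t ∂β := integral_mono_ae hint.integral_prod_left (integrable_const _) h1
      _ = t := by rw [integral_const, probReal_univ, one_smul]
  calc P {y | t + c ≤ ∫ θ, L θ y ∂β}
      ≤ P {y | c ≤ |∫ θ, L θ y ∂β - ∫ y, ∫ θ, L θ y ∂β ∂P|} :=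
        measure_mono fun y (hy : t + c ≤ _) => (by linarith : c ≤ _).trans (le_abs_self _)
    _ ≤ ENNReal.ofReal (variance (fun y => ∫ θ, L θ y ∂β) P / c ^ 2) :=
        meas_ge_le_variance_div_sq hmem hc
    _ ≤ ENNReal.ofReal (t / c ^ 2) := by
        gcongr
        exact ENNReal.toReal_le_of_le_ofReal ht hvar

end Chebyshev

lemma ae_cond_of_forall_mem_of_measurableSet {X : Type*} [MeasurableSpace X] {μ : Measure X}
    {s : Set X} {P : X → Prop} (hP : MeasurableSet {x | P x}) (h : ∀ x ∈ s, P x) :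
    ∀ᵐ x ∂(cond μ s), P x :=
  Measure.smul_absolutelyContinuous.ae_le <|
    (ae_restrict_iff hP).2 (Eventually.of_forall h)

namespace BayesModel

variable {p d : ℕ} (M : BayesModel p d) {n : ℕ} {α : ℝ} {θ θ₀ : Vec d}

/-! ### The likelihood ratio on the neighbourhood of the true parameter -/

/-- The log-likelihood ratio `log (p(y | θ₀) / p(y | θ))`. It takes the value `log 0 = 0` where
either likelihood vanishes. -/
noncomputable def logRatio (n : ℕ) (θ₀ θ : Vec d) (y : Fin n → Vec p) : ℝ :=
  Real.log (M.lik n θ₀ y / M.lik n θ y)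

lemma measurable_logRatio (n : ℕ) (θ₀ : Vec d) :
    Measurable (Function.uncurry (M.logRatio n θ₀)) :=
  Real.measurable_log.comp
    (((M.measurable_lik n θ₀).comp measurable_snd).div (M.measurable_lik_uncurry n))

lemma ae_law_lik_pos : ∀ᵐ y ∂(M.law n θ), 0 < M.lik n θ y :=
  (ae_withDensity_iff (M.measurable_lik n θ).ennreal_ofReal).2 <|
    Eventually.of_forall fun _ hy => ENNReal.ofReal_pos.1 (pos_iff_ne_zero.2 hy)

lemma llr_law_ae_eq (hθ : θ ∈ M.Θ) (hθ₀ : θ₀ ∈ M.Θ) (hac : M.law n θ₀ ≪ M.law n θ) :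
    llr (M.law n θ₀) (M.law n θ) =ᵐ[M.law n θ₀] M.logRatio n θ₀ θ := by
  have := M.isProbabilityMeasure_law (n := n) hθ
  have := M.isProbabilityMeasure_law (n := n) hθ₀
  unfold law at *
  filter_upwards [hac.ae_le (rnDeriv_withDensity_ofReal (M.measurable_lik n θ₀)
    (M.measurable_lik n θ))] with y hy
  rw [llr, hy, logRatio, ENNReal.toReal_div, ENNReal.toReal_ofReal (M.lik_nonneg n _ y),
    ENNReal.toReal_ofReal (M.lik_nonneg n _ y)]

section KLBall

variable {ε : ℝ}

lemma law_absolutelyContinuous_of_mem_klBall (hθ : θ ∈ M.klBall n θ₀ ε) :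
    M.law n θ₀ ≪ M.law n θ :=
  (klDiv_ne_top_iff.1 (ne_top_of_le_ne_top ENNReal.ofReal_ne_top hθ.2.1)).1

lemma integral_logRatio_le (hθ₀ : θ₀ ∈ M.Θ) (hθ : θ ∈ M.klBall n θ₀ ε) :
    ∫ y, M.logRatio n θ₀ θ y ∂(M.law n θ₀) ≤ n * ε ^ 2 := by
  have := M.isProbabilityMeasure_law (n := n) hθ.1
  have := M.isProbabilityMeasure_law (n := n) hθ₀
  have hac := M.law_absolutelyContinuous_of_mem_klBall hθ
  rw [← integral_congr_ae (M.llr_law_ae_eq hθ.1 hθ₀ hac),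
    ← toReal_klDiv_of_measure_eq hac (by rw [measure_univ, measure_univ])]
  exact ENNReal.toReal_le_of_le_ofReal (by positivity) hθ.2.1

lemma lintegral_sq_logRatio_le (hθ₀ : θ₀ ∈ M.Θ) (hθ : θ ∈ M.klBall n θ₀ ε) :
    ∫⁻ y, ‖M.logRatio n θ₀ θ y‖ₑ ^ 2 ∂(M.law n θ₀) ≤ ENNReal.ofReal (n * ε ^ 2) := by
  have hac := M.law_absolutelyContinuous_of_mem_klBall hθ
  have hv := hθ.2.2
  rw [vDiv, if_pos hac] at hv
  refine (lintegral_congr_ae ?_).trans_le hv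
  filter_upwards [M.llr_law_ae_eq hθ.1 hθ₀ hac] with y hy
  rw [hy, ← sq_abs (M.logRatio n θ₀ θ y), ENNReal.ofReal_pow (abs_nonneg _),
    ← Real.enorm_eq_ofReal_abs]

lemma ae_law_ae_cond_klBall_lik_pos (hθ₀ : θ₀ ∈ M.Θ) :
    ∀ᵐ y ∂(M.law n θ₀), ∀ᵐ θ ∂(cond M.priorMeasure (M.klBall n θ₀ ε)), 0 < M.lik n θ y := by
  have := M.isProbabilityMeasure_law (n := n) hθ₀
  have hmeas : MeasurableSet {z : Vec d × (Fin n → Vec p) | 0 < M.lik n z.1 z.2} :=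
    measurableSet_lt measurable_const (M.measurable_lik_uncurry n)
  refine (Measure.ae_ae_comm (p := fun θ y => 0 < M.lik n θ y) hmeas).1 <|
    ae_cond_of_forall_mem_of_measurableSet
      (measurable_measure_prodMk_left hmeas.compl (measurableSet_singleton 0)) fun θ hθ =>
        (M.law_absolutelyContinuous_of_mem_klBall hθ).ae_le M.ae_law_lik_pos

lemma ofReal_le_fracUnnorm_univ {S : Set (Vec d)} (hS : M.priorMeasure S ≠ 0)
    {y : Fin n → Vec p} (hy : 0 < M.lik n θ₀ y)
    (hpos : ∀ᵐ θ ∂(cond M.priorMeasure S), 0 < M.lik n θ y)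
    (hint : Integrable (fun θ => M.logRatio n θ₀ θ y) (cond M.priorMeasure S)) :
    ENNReal.ofReal (M.lik n θ₀ y ^ α) * (M.priorMeasure S * ENNReal.ofReal
      (Real.exp (-α * ∫ θ, M.logRatio n θ₀ θ y ∂(cond M.priorMeasure S)))) ≤
      M.fracUnnorm α n y Set.univ := by
  have := cond_isProbabilityMeasure hS
  have hratio : ∀ᵐ θ ∂(cond M.priorMeasure S),
      ENNReal.ofReal (M.lik n θ₀ y ^ α) * ENNReal.ofReal (Real.exp (-α * M.logRatio n θ₀ θ y)) =
        ENNReal.ofReal (M.lik n θ y ^ α) := by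
    filter_upwards [hpos] with θ hθ
    rw [← ENNReal.ofReal_mul (by positivity), logRatio, Real.log_div hy.ne' hθ.ne',
      Real.rpow_def_of_pos hy, Real.rpow_def_of_pos hθ, ← Real.exp_add]
    ring_nf
  calc ENNReal.ofReal (M.lik n θ₀ y ^ α) * (M.priorMeasure S * ENNReal.ofReal
        (Real.exp (-α * ∫ θ, M.logRatio n θ₀ θ y ∂(cond M.priorMeasure S))))
      ≤ ENNReal.ofReal (M.lik n θ₀ y ^ α) * (M.priorMeasure S * ∫⁻ θ, ENNReal.ofReal
          (Real.exp (-α * M.logRatio n θ₀ θ y)) ∂(cond M.priorMeasure S)) := by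
        gcongr
        rw [← integral_const_mul]
        exact ofReal_exp_integral_le (hint.const_mul _)
    _ = M.priorMeasure S *
          ∫⁻ θ, ENNReal.ofReal (M.lik n θ y ^ α) ∂(cond M.priorMeasure S) := by
        rw [mul_left_comm, ← lintegral_const_mul' _ _ ENNReal.ofReal_ne_top,
          lintegral_congr_ae hratio]
    _ = ∫⁻ θ in S, ENNReal.ofReal (M.lik n θ y ^ α) ∂M.priorMeasure := by
        rw [ProbabilityTheory.cond, lintegral_smul_measure, smul_eq_mul, ← mul_assoc,
          ENNReal.mul_inv_cancel hS (measure_ne_top _ _), one_mul]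
    _ ≤ ∫⁻ θ, ENNReal.ofReal (M.lik n θ y ^ α) ∂M.priorMeasure := setLIntegral_le_lintegral _ _
    _ = M.fracUnnorm α n y Set.univ := by
        rw [fracUnnorm_eq_withDensity, withDensity_apply _ MeasurableSet.univ, setLIntegral_univ]

lemma law_fracUnnorm_univ_lt_le (hα : 0 ≤ α) (hθ₀ : θ₀ ∈ M.Θ)
    (hB : M.priorMeasure (M.klBall n θ₀ ε) ≠ 0) {c : ℝ} (hc : 0 < c) :
    M.law n θ₀ {y | M.fracUnnorm α n y Set.univ < ENNReal.ofReal (M.lik n θ₀ y ^ α) *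
      (M.priorMeasure (M.klBall n θ₀ ε) * ENNReal.ofReal (Real.exp (-α * (n * ε ^ 2 + c))))} ≤
      ENNReal.ofReal (n * ε ^ 2 / c ^ 2) := by
  have := M.isProbabilityMeasure_law (n := n) hθ₀
  have := cond_isProbabilityMeasure hB
  have hL := M.measurable_logRatio n θ₀
  have h1 : ∀ᵐ θ ∂(cond M.priorMeasure (M.klBall n θ₀ ε)),
      ∫ y, M.logRatio n θ₀ θ y ∂(M.law n θ₀) ≤ n * ε ^ 2 :=
    ae_cond_of_forall_mem_of_measurableSet
      (measurableSet_le hL.stronglyMeasurable.integral_prod_right'.measurable measurable_const)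
      fun θ => M.integral_logRatio_le hθ₀
  have h2 : ∀ᵐ θ ∂(cond M.priorMeasure (M.klBall n θ₀ ε)),
      ∫⁻ y, ‖M.logRatio n θ₀ θ y‖ₑ ^ 2 ∂(M.law n θ₀) ≤ ENNReal.ofReal (n * ε ^ 2) :=
    ae_cond_of_forall_mem_of_measurableSet
      (measurableSet_le (hL.enorm.pow_const 2).lintegral_prod_right' measurable_const)
      fun θ => M.lintegral_sq_logRatio_le hθ₀
  refine (measure_mono_ae ?_).trans (measure_add_le_integral_le hL (by positivity) h2 h1 hc)
  filter_upwards [M.ae_law_lik_pos, M.ae_law_ae_cond_klBall_lik_pos hθ₀,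
    (integrable_uncurry_of_lintegral_sq_le hL h2).prod_left_ae] with y hy hpos hint hlt
  change _ < _ at hlt
  by_contra hW
  refine (lt_irrefl _ (hlt.trans_le (le_trans ?_ (M.ofReal_le_fracUnnorm_univ hB hy hpos hint))))
  have hexp : -α * (n * ε ^ 2 + c) ≤
      -α * ∫ θ, M.logRatio n θ₀ θ y ∂(cond M.priorMeasure (M.klBall n θ₀ ε)) :=
    mul_le_mul_of_nonpos_left (not_le.1 hW).le (neg_nonpos.2 hα)
  gcongr

end KLBall

/-! ### The prior average of the normalised likelihood powers -/

lemma lintegral_inv_affinity_fracUnnorm (y : Fin n → Vec p) :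
    ∫⁻ θ, (M.affinity α n θ θ₀)⁻¹ ∂(M.fracUnnorm α n y) =
      ∫⁻ θ, ENNReal.ofReal (M.lik n θ y ^ α) * (M.affinity α n θ θ₀)⁻¹ ∂M.priorMeasure := by
  rw [fracUnnorm_eq_withDensity]
  exact lintegral_withDensity_eq_lintegral_mul _ (by fun_prop) (M.measurable_affinity n α θ₀).inv

lemma measurable_lik_mul_inv_affinity : Measurable fun z : (Fin n → Vec p) × Vec d =>
    ENNReal.ofReal (M.lik n z.2 z.1 ^ α) * (M.affinity α n z.2 θ₀)⁻¹ :=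
  (((M.measurable_lik_uncurry n).comp measurable_swap).pow_const α).ennreal_ofReal.mul
    ((M.measurable_affinity n α θ₀).inv.comp measurable_snd)

lemma lintegral_law_inv_mul_le {F : (Fin n → Vec p) → ℝ≥0∞} (hF : Measurable F) :
    ∫⁻ y, (ENNReal.ofReal (M.lik n θ y ^ α))⁻¹ * F y ∂(M.law n θ) ≤
      ∫⁻ y, ENNReal.ofReal (M.lik n θ y ^ (1 - α)) * F y := by
  rw [law, lintegral_withDensity_eq_lintegral_mul _ (by fun_prop) (by fun_prop)]
  refine lintegral_mono fun y => ?_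
  rw [Pi.mul_apply, ← mul_assoc]
  rcases (M.lik_nonneg n θ y).eq_or_lt with h0 | h0
  · rw [← h0, ENNReal.ofReal_zero, zero_mul, zero_mul]
    exact zero_le
  · rw [← ENNReal.ofReal_inv_of_pos (by positivity), ← ENNReal.ofReal_mul h0.le,
      Real.rpow_sub h0, Real.rpow_one, div_eq_mul_inv]

lemma lintegral_lintegral_inv_affinity_le_one :
    ∫⁻ y, (ENNReal.ofReal (M.lik n θ₀ y ^ α))⁻¹ *
      ∫⁻ θ, (M.affinity α n θ θ₀)⁻¹ ∂(M.fracUnnorm α n y) ∂(M.law n θ₀) ≤ 1 := by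
  have hjoint := M.measurable_lik_mul_inv_affinity (n := n) (α := α) (θ₀ := θ₀)
  simp only [M.lintegral_inv_affinity_fracUnnorm]
  refine (M.lintegral_law_inv_mul_le hjoint.lintegral_prod_right').trans ?_
  calc ∫⁻ y, ENNReal.ofReal (M.lik n θ₀ y ^ (1 - α)) *
        ∫⁻ θ, ENNReal.ofReal (M.lik n θ y ^ α) * (M.affinity α n θ θ₀)⁻¹ ∂M.priorMeasure
      = ∫⁻ y, ∫⁻ θ, ENNReal.ofReal (M.lik n θ₀ y ^ (1 - α)) *
          (ENNReal.ofReal (M.lik n θ y ^ α) * (M.affinity α n θ θ₀)⁻¹) ∂M.priorMeasure :=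
        lintegral_congr fun y => (lintegral_const_mul' _ _ ENNReal.ofReal_ne_top).symm
    _ = ∫⁻ θ, (∫⁻ y, ENNReal.ofReal (M.lik n θ₀ y ^ (1 - α)) *
          (ENNReal.ofReal (M.lik n θ y ^ α) * (M.affinity α n θ θ₀)⁻¹)) ∂M.priorMeasure :=
        lintegral_lintegral_swap
          ((((M.measurable_lik n θ₀).pow_const (1 - α)).ennreal_ofReal.comp measurable_fst).mul
            hjoint).aemeasurable
    _ = ∫⁻ θ, (M.affinity α n θ θ₀)⁻¹ * M.affinity α n θ θ₀ ∂M.priorMeasure := by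
        refine lintegral_congr fun θ => ?_
        rw [affinity, ← lintegral_const_mul _ (by fun_prop)]
        refine lintegral_congr fun y => ?_
        rw [ENNReal.ofReal_mul (Real.rpow_nonneg (M.lik_nonneg n θ y) α)]
        ring
    _ ≤ ∫⁻ _, 1 ∂M.priorMeasure := lintegral_mono fun θ => ENNReal.inv_mul_le_one _
    _ = 1 := by rw [lintegral_const, measure_univ, one_mul]

lemma law_lt_lintegral_inv_affinity_le {x : ℝ} (hx : 0 < x) :
    M.law n θ₀ {y | ENNReal.ofReal (M.lik n θ₀ y ^ α) * ENNReal.ofReal x <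
      ∫⁻ θ, (M.affinity α n θ θ₀)⁻¹ ∂(M.fracUnnorm α n y)} ≤ ENNReal.ofReal (1 / x) := by
  have hmeas : Measurable fun y =>
      ∫⁻ θ, (M.affinity α n θ θ₀)⁻¹ ∂(M.fracUnnorm α n y) := by
    simp only [M.lintegral_inv_affinity_fracUnnorm]
    exact M.measurable_lik_mul_inv_affinity.lintegral_prod_right'
  calc M.law n θ₀ {y | ENNReal.ofReal (M.lik n θ₀ y ^ α) * ENNReal.ofReal x <
        ∫⁻ θ, (M.affinity α n θ θ₀)⁻¹ ∂(M.fracUnnorm α n y)}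
      ≤ M.law n θ₀ {y | ENNReal.ofReal x ≤ (ENNReal.ofReal (M.lik n θ₀ y ^ α))⁻¹ *
          ∫⁻ θ, (M.affinity α n θ θ₀)⁻¹ ∂(M.fracUnnorm α n y)} := by
        refine measure_mono_ae ?_
        filter_upwards [M.ae_law_lik_pos] with y hy hlt
        change _ ≤ _
        rw [mul_comm, ← div_eq_mul_inv, ENNReal.le_div_iff_mul_le
          (Or.inl (ENNReal.ofReal_pos.2 (Real.rpow_pos_of_pos hy α)).ne')
          (Or.inl ENNReal.ofReal_ne_top), mul_comm]
        exact le_of_lt hlt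
    _ ≤ (∫⁻ y, (ENNReal.ofReal (M.lik n θ₀ y ^ α))⁻¹ *
          ∫⁻ θ, (M.affinity α n θ θ₀)⁻¹ ∂(M.fracUnnorm α n y) ∂(M.law n θ₀)) / ENNReal.ofReal x :=
        meas_ge_le_lintegral_div (by fun_prop) (ENNReal.ofReal_pos.2 hx).ne' ENNReal.ofReal_ne_top
    _ ≤ 1 / ENNReal.ofReal x := by
        gcongr
        exact M.lintegral_lintegral_inv_affinity_le_one
    _ = ENNReal.ofReal (1 / x) := by rw [ENNReal.ofReal_div_of_pos hx, ENNReal.ofReal_one]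

end BayesModel

/-! ### An event of high probability -/

lemma ofReal_div_mul_exp_neg {b : ℝ≥0∞} (hb0 : b ≠ 0) (hb : b ≠ ∞) (x s : ℝ) :
    ENNReal.ofReal x / (b * ENNReal.ofReal (Real.exp (-s))) =
      ENNReal.ofReal (x * Real.exp s / b.toReal) := by
  have hpos := ENNReal.toReal_pos hb0 hb
  nth_rw 1 [← ENNReal.ofReal_toReal hb]
  rw [← ENNReal.ofReal_mul hpos.le, ← ENNReal.ofReal_div_of_pos (by positivity), Real.exp_neg]
  congr 1
  field_simp

namespace BayesModel

variable {p d : ℕ} (M : BayesModel p d) {n : ℕ} {α : ℝ} {θ₀ : Vec d}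

lemma lintegral_inv_affinity_fracPosterior_le {y : Fin n → Vec p} {W X : ℝ≥0∞}
    (hden : ENNReal.ofReal (M.lik n θ₀ y ^ α) * W ≤ M.fracUnnorm α n y Set.univ)
    (hnum : ∫⁻ θ, (M.affinity α n θ θ₀)⁻¹ ∂(M.fracUnnorm α n y) ≤
      ENNReal.ofReal (M.lik n θ₀ y ^ α) * X) :
    ∫⁻ θ, (M.affinity α n θ θ₀)⁻¹ ∂(M.fracPosterior α n y) ≤ X / W := by
  rw [fracPosterior, lintegral_smul_measure, smul_eq_mul]
  rcases eq_or_ne (ENNReal.ofReal (M.lik n θ₀ y ^ α)) 0 with h0 | h0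
  · rw [h0, zero_mul, nonpos_iff_eq_zero] at hnum
    rw [hnum, mul_zero]
    exact zero_le
  calc (M.fracUnnorm α n y Set.univ)⁻¹ * ∫⁻ θ, (M.affinity α n θ θ₀)⁻¹ ∂(M.fracUnnorm α n y)
      ≤ (ENNReal.ofReal (M.lik n θ₀ y ^ α) * W)⁻¹ * (ENNReal.ofReal (M.lik n θ₀ y ^ α) * X) := by
        gcongr
    _ = X / W := by
        rw [mul_comm, ← div_eq_mul_inv, ENNReal.mul_div_mul_left _ _ h0 ENNReal.ofReal_ne_top]

theorem exists_event_lintegral_inv_affinity_fracPosterior_le (hα : 0 ≤ α) (hθ₀ : θ₀ ∈ M.Θ) {ε : ℝ}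
    (hB : M.priorMeasure (M.klBall n θ₀ ε) ≠ 0) {c x : ℝ} (hc : 0 < c) (hx : 0 < x) :
    ∃ A : Set (Fin n → Vec p), MeasurableSet A ∧
      1 - ENNReal.ofReal (n * ε ^ 2 / c ^ 2 + 1 / x) ≤ M.law n θ₀ A ∧
      ∀ y ∈ A, ∫⁻ θ, (M.affinity α n θ θ₀)⁻¹ ∂(M.fracPosterior α n y) ≤ ENNReal.ofReal
        (x * Real.exp (α * (n * ε ^ 2 + c)) / (M.priorMeasure (M.klBall n θ₀ ε)).toReal) := by
  have := M.isProbabilityMeasure_law (n := n) hθ₀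
  set W := M.priorMeasure (M.klBall n θ₀ ε) * ENNReal.ofReal (Real.exp (-α * (n * ε ^ 2 + c)))
  set L := fun y => ENNReal.ofReal (M.lik n θ₀ y ^ α)
  set lowEvidence := {y | M.fracUnnorm α n y Set.univ < L y * W}
  set highNumerator := {y | L y * ENNReal.ofReal x <
    ∫⁻ θ, (M.affinity α n θ θ₀)⁻¹ ∂(M.fracUnnorm α n y)}
  set bad := toMeasurable (M.law n θ₀) (lowEvidence ∪ highNumerator)
  have hbad : M.law n θ₀ bad ≤ ENNReal.ofReal (n * ε ^ 2 / c ^ 2 + 1 / x) := by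
    rw [measure_toMeasurable, ENNReal.ofReal_add (by positivity) (by positivity)]
    exact (measure_union_le _ _).trans (add_le_add (M.law_fracUnnorm_univ_lt_le hα hθ₀ hB hc)
      (M.law_lt_lintegral_inv_affinity_le hx))
  refine ⟨badᶜ, (measurableSet_toMeasurable _ _).compl, ?_, fun y hy => ?_⟩
  · rw [prob_compl_eq_one_sub (measurableSet_toMeasurable _ _)]
    exact tsub_le_tsub_left hbad 1
  · have hgood : y ∉ lowEvidence ∪ highNumerator := fun h => hy (subset_toMeasurable _ _ h)
    rw [← ofReal_div_mul_exp_neg hB (measure_ne_top _ _), ← neg_mul]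
    exact M.lintegral_inv_affinity_fracPosterior_le
      (not_lt.1 fun h => hgood (Or.inl h)) (not_lt.1 fun h => hgood (Or.inr h))

end BayesModel

/-! ### Choice of the constants -/

lemma deviation_add_inv_eq {D t : ℝ} (hD : 1 < D) (ht : 0 < t) :
    t / (3 / 4 * (D - 1) * t) ^ 2 + 1 / (9 / 2 * (D - 1) ^ 2 * t) = 2 / ((D - 1) ^ 2 * t) := by
  have := sub_pos.2 hD
  field_simp
  norm_num

/-- The additive constant of the risk bound, before division by the sample size. -/
noncomputable def riskConst (α D : ℝ) : ℝ := |Real.log (18 * (D - 1) / α)| / (1 - α)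

lemma log_mul_exp_div_le {α D t b : ℝ} (hα : 0 < α) (hD : 1 < D) (ht : 0 < t) (hb : 0 < b) :
    Real.log (9 / 2 * (D - 1) ^ 2 * t * Real.exp (α * (t + 3 / 4 * (D - 1) * t)) / b) ≤
      D * α * t + Real.log b⁻¹ + |Real.log (18 * (D - 1) / α)| := by
  have hD' := sub_pos.2 hD
  have hfactor : 9 / 2 * (D - 1) ^ 2 * t = 18 * (D - 1) / α * (α * (D - 1) * t / 4) := by
    field_simp
    norm_num
  have htangent := Real.log_le_sub_one_of_pos (show 0 < α * (D - 1) * t / 4 by positivity)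
  have habs := le_abs_self (Real.log (18 * (D - 1) / α))
  rw [hfactor, Real.log_div (by positivity) hb.ne', Real.log_mul (by positivity) (by positivity),
    Real.log_mul (by positivity) (by positivity), Real.log_exp, Real.log_inv]
  linarith

lemma log_div_le_riskConst {α D ε b : ℝ} {n : ℕ} (hα₀ : 0 < α) (hα₁ : α < 1) (hD : 1 < D)
    (hn : 1 ≤ n) (hε : 0 < ε) (hb : 0 < b) :
    Real.log (9 / 2 * (D - 1) ^ 2 * (n * ε ^ 2) *
        Real.exp (α * (n * ε ^ 2 + 3 / 4 * (D - 1) * (n * ε ^ 2))) / b) / (n * (1 - α)) ≤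
      D * α / (1 - α) * ε ^ 2 + 1 / (n * (1 - α)) * Real.log b⁻¹ + riskConst α D / n := by
  have hα := sub_pos.2 hα₁
  have : (0 : ℝ) < n := Nat.cast_pos.2 hn
  calc
    _ ≤ (D * α * (n * ε ^ 2) + Real.log b⁻¹ + |Real.log (18 * (D - 1) / α)|) /
        (n * (1 - α)) := by
        gcongr
        exact log_mul_exp_div_le hα₀ hD (by positivity) hb
    _ = _ := by
        rw [riskConst]
        field_simp

end GPIVI

theorem theorem4p2 (α D : ℝ) (hα₀ : 0 < α) (hα₁ : α < 1) (hD : 1 < D) :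
    ∃ C : ℝ, 0 ≤ C ∧
      ∀ (p d : ℕ) (M : GPIVI.BayesModel p d) (θ₀ : GPIVI.Vec d), θ₀ ∈ M.Θ →
      ∀ (n : ℕ) (ε : ℝ), 1 ≤ n → 0 < ε → 0 < M.priorMeasure (M.klBall n θ₀ ε) →
      -- an event of probability at least `1 - 2 / ((D - 1)² n ε²)` under the true law of the data
      ∃ A : Set (Fin n → GPIVI.Vec p), MeasurableSet A ∧
        1 - ENNReal.ofReal (2 / ((D - 1) ^ 2 * n * ε ^ 2)) ≤ M.law n θ₀ A ∧
        -- the bound for GP-IVI, and the same bound for the unrestricted variational family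
        ∀ 𝒬 : Set (GPIVI.Vec d → ℝ), 𝒬 = GPIVI.gpFamily d ∨ 𝒬 = GPIVI.allDensities d →
        ∀ y ∈ A, ∀ q : GPIVI.Vec d → ℝ, M.IsAlphaVBMinimiser 𝒬 α n y q →
          GPIVI.densMeasure q ≪ M.priorMeasure →
          M.risk α n θ₀ q ≤ ENNReal.ofReal
            (D * α / (1 - α) * ε ^ 2
              + 1 / (n * (1 - α)) * Real.log ((M.priorMeasure (M.klBall n θ₀ ε)).toReal)⁻¹
              + C / n) := by
  refine ⟨GPIVI.riskConst α D, div_nonneg (abs_nonneg _) (sub_pos.2 hα₁).le,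
    fun p d M θ₀ hθ₀ n ε hn hε hB => ?_⟩
  have := sub_pos.2 hD
  have : (0 : ℝ) < n := Nat.cast_pos.2 hn
  have ht : 0 < n * ε ^ 2 := by positivity
  obtain ⟨A, hA, hprob, hpost⟩ := M.exists_event_lintegral_inv_affinity_fracPosterior_le hα₀.le
    hθ₀ hB.ne' (c := 3 / 4 * (D - 1) * (n * ε ^ 2)) (x := 9 / 2 * (D - 1) ^ 2 * (n * ε ^ 2))
    (by positivity) (by positivity)
  rw [GPIVI.deviation_add_inv_eq hD ht, ← mul_assoc] at hprob
  refine ⟨A, hA, hprob, fun 𝒬 h𝒬 y hy q hq _ => ?_⟩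
  refine (hq.risk_le M hα₀.le hα₁ hθ₀ hn h𝒬 (hpost y hy)).trans (ENNReal.ofReal_le_ofReal ?_)
  exact GPIVI.log_div_le_riskConst hα₀ hα₁ hD hn hε
    (ENNReal.toReal_pos hB.ne' (measure_ne_top _ _))
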